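/- Let $\mathcal G_n$ be the $n$-qubit Pauli group (all tensor products of $I,X,Y,Z$ with phases $\pm1,\pm i$). Let $\overline Z_1,\dots,\overline Z_{s+c+r},\overline X_{s+1},\dots,\overline X_{s+c+r}\in\mathcal G_n$ be such that all $\overline Z$'s commute with each other, all $\overline X$'s commute with each other, $\overline X_i$ commutes with $\overline Z_j$ for $i\ne j$ and anticommutes with $\overline Z_i$, and such that the group $\mathcal S$ that they generate has size $2^{s+2(c+r)}$ up to phases (that is, $|\mathcal S/(\mathcal S\cap\{\pm I,\pm iI\})|=2^{s+2(c+r)}$). Let $\mathcal S_I=\langle\overline Z_1,\dots,\overline Z_s\rangle$ (isotropic subgroup), $\mathcal S_E=\langle\overline Z_{s+1},\dots,\overline Z_{s+c},\overline X_{s+1},\dots,\overline X_{s+c}\rangle$ (entanglement subgroup) and $\mathcal S_G=\langle\overline Z_{s+c+1},\dots,\overline Z_{s+c+r},\overline X_{s+c+1},\dots,\overline X_{s+c+r}\rangle$ (gauge subgroup). Then $s+c+r\le n$, and with $k=n-s-c-r$ there is an $[[n,k;r,c]]$ entanglement-assisted operator code defined by $(\mathcal S_I,\mathcal S_E,\mathcal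 S_G)$, in the following sense. There is a unitary $V$ from the register of $s$ ancilla, $c$ ebit, $r$ gauge and $k$ logical qubits onto $n$ qubits such that $VZ_iV^\dagger=\overline Z_i$ for $1\le i\le s+c+r$ and $VX_jV^\dagger=\overline X_j$ for $s+1\le j\le s+c+r$, up to a phase for each generator. The code has the encoding $$\mathcal E_\sigma(\rho)=(V\otimes I_B)\,\bigl(|\mathbf 0\rangle\langle\mathbf 0|\otimes\Phi^{\otimes c}\otimes\sigma\otimes\rho\bigr)\,(V\otimes I_B)^\dagger ,$$ where $|\mathbf 0\rangle$ is the state of the $s$ ancillas, $\Phi$ is a maximally entangled pair of qubits shared by the sender (first half, on which $V$ acts) and the receiver $B$, $\sigma$ is an arbitrary state of the $r$ gauge qubits, and $\rho$ is the state of the $k$ logical qubits. Moreover this one encoding has the following property. Let $\mathbf E\subseteq\mathcal G_n$ be any error set such that for all $E_1,E_2\in\mathbf E$, $$E_2^\dagger E_1\in\langle\mathcal S_I,\mathcal S_G\rangle\ \text{ up to a phase in } \{\pm1,\pm i\},\qquad\text{or}\qquad E_2^\dagger E_1\notin\mathcal Z(\langle\mathcal S_I,\mathcal S_E\rangle),$$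 where $\mathcal Z$ is the centralizer in $\mathcal G_n$. Then there is a decoding quantum channel $\mathcal D$, from the $n$ transmitted qubits and the receiver's $c$ halves of ebits to $k$ qubits, such that the pair $(\mathcal E,\mathcal D)$ corrects $\mathbf E$: for every $E\in\mathbf E$, every state $\sigma$ of the gauge qubits and every $\rho$, $$\mathcal D\bigl((E\otimes I_B)\,\mathcal E_\sigma(\rho)\,(E\otimes I_B)^\dagger\bigr)=\rho .$$ -/

import Mathlib

open scoped Kronecker ComplexOrder

noncomputable section

namespace EAOQ

/-- Labels of the computational basis of `m` qubits. -/
abbrev Q (m : ℕ) : Type := Fin m → Fin 2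

/-- Operators on a register whose basis is labelled by `A`. -/
abbrev Op (A : Type) : Type := Matrix A A ℂ

/-! ### The Pauli group -/

def sigmaX : Op (Fin 2) := !![0, 1; 1, 0]

def sigmaZ : Op (Fin 2) := !![1, 0; 0, -1]

/-- The tensor product `A 0 ⊗ ⋯ ⊗ A (m - 1)` of one-qubit operators. -/
def tensor {m : ℕ} (A : Fin m → Op (Fin 2)) : Op (Q m) :=
  Matrix.of fun x y => ∏ i, A i (x i) (y i)

/-- The one-qubit operator `B` on qubit `j`, and the identity on the other qubits. -/
def onQubit {m : ℕ} (j : Fin m) (B : Op (Fin 2)) : Op (Q m) :=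
  tensor (Function.update (fun _ => 1) j B)

theorem tensor_mul {m : ℕ} (A B : Fin m → Op (Fin 2)) :
    tensor A * tensor B = tensor (fun i => A i * B i) := by
  ext x y
  simp only [tensor, Matrix.mul_apply, Matrix.of_apply, ← Finset.prod_mul_distrib]
  rw [Finset.prod_univ_sum]
  simp

theorem tensor_one {m : ℕ} : tensor (fun _ : Fin m => (1 : Op (Fin 2))) = 1 := by
  ext x y
  simp only [tensor, Matrix.of_apply, Matrix.one_apply, Finset.prod_boole, Finset.mem_univ,
    true_imp_iff, funext_iff]

theorem onQubit_sq {m : ℕ} (j : Fin m) {B : Op (Fin 2)} (h : B * B = 1) :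
    onQubit j B * onQubit j B = 1 := by
  rw [onQubit, tensor_mul, ← tensor_one]
  congr 1
  funext i
  by_cases hi : i = j
  · subst hi; simpa using h
  · simp [hi]

theorem onQubit_star {m : ℕ} (j : Fin m) {B : Op (Fin 2)} (h : star B = B) :
    star (onQubit j B) = onQubit j B := by
  have hB : ∀ a b, star (B b a) = B a b := fun a b => congrFun (congrFun h a) b
  ext x y
  simp only [onQubit, tensor, Matrix.star_apply, Matrix.of_apply, star_prod]
  refine Finset.prod_congr rfl fun i _ => ?_
  by_cases hi : i = j
  · subst hi; simpa using hB _ _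
  · simp [hi, Matrix.one_apply, eq_comm, apply_ite star]

theorem sigmaX_sq : sigmaX * sigmaX = 1 := by
  ext a b; fin_cases a <;> fin_cases b <;> simp [sigmaX]

theorem sigmaZ_sq : sigmaZ * sigmaZ = 1 := by
  ext a b; fin_cases a <;> fin_cases b <;> simp [sigmaZ]

theorem sigmaX_star : star sigmaX = sigmaX := by
  ext a b; fin_cases a <;> fin_cases b <;> simp [sigmaX, Matrix.star_apply]

theorem sigmaZ_star : star sigmaZ = sigmaZ := by
  ext a b; fin_cases a <;> fin_cases b <;> simp [sigmaZ, Matrix.star_apply]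

/-- The Pauli operator `X` on qubit `j`, as a unitary. -/
def pauliX {m : ℕ} (j : Fin m) : Matrix.unitaryGroup (Q m) ℂ :=
  ⟨onQubit j sigmaX, by
    rw [Matrix.mem_unitaryGroup_iff, onQubit_star j sigmaX_star, onQubit_sq j sigmaX_sq]⟩

/-- The Pauli operator `Z` on qubit `j`, as a unitary. -/
def pauliZ {m : ℕ} (j : Fin m) : Matrix.unitaryGroup (Q m) ℂ :=
  ⟨onQubit j sigmaZ, by
    rw [Matrix.mem_unitaryGroup_iff, onQubit_star j sigmaZ_star, onQubit_sq j sigmaZ_sq]⟩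

/-- The scalar operator `i I`. -/
def iOne (m : ℕ) : Matrix.unitaryGroup (Q m) ℂ :=
  ⟨Complex.I • 1, by
    rw [Matrix.mem_unitaryGroup_iff, star_smul, star_one, smul_mul_smul_comm, one_mul]
    simp⟩

/-- The Pauli group on `n` qubits: all tensor products of `I, X, Y, Z` with a phase
`±1` or `±i`. -/
def pauliGroup (n : ℕ) : Subgroup (Matrix.unitaryGroup (Q n) ℂ) :=
  Subgroup.closure ({iOne n} ∪ Set.range pauliX ∪ Set.range pauliZ)

theorem iOne_mem (n : ℕ) : iOne n ∈ pauliGroup n :=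
  Subgroup.subset_closure (Or.inl (Or.inl rfl))

/-- The phases `I, iI, -I, -iI` in the Pauli group. -/
def phases (n : ℕ) : Subgroup (pauliGroup n) :=
  Subgroup.zpowers ⟨iOne n, iOne_mem n⟩

/-- The matrix of a Pauli group element. -/
def toOp {n : ℕ} (g : pauliGroup n) : Op (Q n) := (g : Matrix.unitaryGroup (Q n) ℂ)

/-! ### Isotropic, entanglement and gauge subgroups -/

/-- Generators of a subgroup `S` of the Pauli group: `s` isotropic generators, `c` symplectic
pairs for the entanglement subgroup and `r` symplectic pairs for the gauge subgroup, with the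
canonical commutation relations, such that `S` has, up to phases, the full size
`2 ^ (s + 2 (c + r))`. -/
structure Generators (n s c r : ℕ) where
  Zbar : Fin s ⊕ (Fin c ⊕ Fin r) → pauliGroup n
  Xbar : Fin c ⊕ Fin r → pauliGroup n
  comm_ZZ : ∀ i j, toOp (Zbar i) * toOp (Zbar j) = toOp (Zbar j) * toOp (Zbar i)
  comm_XX : ∀ i j, toOp (Xbar i) * toOp (Xbar j) = toOp (Xbar j) * toOp (Xbar i)
  comm_XZ : ∀ i j, j ≠ Sum.inr i →
    toOp (Xbar i) * toOp (Zbar j) = toOp (Zbar j) * toOp (Xbar i)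
  anticomm : ∀ i,
    toOp (Xbar i) * toOp (Zbar (Sum.inr i)) = -(toOp (Zbar (Sum.inr i)) * toOp (Xbar i))
  -- `relIndex` is the index of `S ∩ phases` in `S`, the number of elements of `S` up to phases
  size : (phases n).relIndex (Subgroup.closure (Set.range Zbar ∪ Set.range Xbar)) =
    2 ^ (s + 2 * (c + r))

namespace Generators

variable {n s c r : ℕ} (G : Generators n s c r)

/-- The isotropic subgroup. -/
def isotropic : Subgroup (pauliGroup n) :=
  Subgroup.closure (Set.range fun i : Fin s => G.Zbar (Sum.inl i))

/-- The entanglement subgroup. -/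
def entanglement : Subgroup (pauliGroup n) :=
  Subgroup.closure ((Set.range fun j : Fin c => G.Zbar (Sum.inr (Sum.inl j))) ∪
    Set.range fun j : Fin c => G.Xbar (Sum.inl j))

/-- The gauge subgroup. -/
def gauge : Subgroup (pauliGroup n) :=
  Subgroup.closure ((Set.range fun l : Fin r => G.Zbar (Sum.inr (Sum.inr l))) ∪
    Set.range fun l : Fin r => G.Xbar (Sum.inr l))

end Generators

/-! ### States and channels -/

/-- Density operators. -/
def IsState {A : Type} [Fintype A] (σ : Op A) : Prop := σ.PosSemidef ∧ σ.trace = 1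

/-- Quantum channels (completely positive trace preserving maps), in Kraus form. -/
def IsChannel {A B : Type} [Fintype A] [DecidableEq A] [Fintype B]
    (D : Op A →ₗ[ℂ] Op B) : Prop :=
  ∃ (N : ℕ) (K : Fin N → Matrix B A ℂ),
    (∑ i, (K i).conjTranspose * K i = 1) ∧
    ∀ ρ, D ρ = ∑ i, K i * ρ * (K i).conjTranspose

/-- The state `|0 ⋯ 0⟩⟨0 ⋯ 0|` of `s` ancillas. -/
def ancilla (s : ℕ) : Op (Q s) := Matrix.single 0 0 1

/-- The vector of `c` ebits, `2 ^ (-c / 2) ∑ e, |e⟩ ⊗ |e⟩`: the first factor is Alice's, the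
second one Bob's. -/
def ebitKet (c : ℕ) : Q c × Q c → ℂ :=
  fun p => if p.1 = p.2 then (((Real.sqrt 2) ^ c : ℝ) : ℂ)⁻¹ else 0

/-- The density operator of `c` ebits. -/
def ebits (c : ℕ) : Op (Q c × Q c) := Matrix.vecMulVec (ebitKet c) (star (ebitKet c))

/-- Alice's register before encoding: ancillas, halves of ebits, gauge qubits, logical qubits. -/
abbrev Reg (s c r k : ℕ) : Type := Q s × (Q c × (Q r × Q k))

/-- The canonical encoding `|0⟩⟨0| ⊗ Φ ⊗ σ ⊗ ρ`, on Alice's register and Bob's halves of the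
ebits. -/
def canonical (s : ℕ) {c r k : ℕ} (σ : Op (Q r)) (ρ : Op (Q k)) : Op (Reg s c r k × Q c) :=
  Matrix.of fun x y =>
    ancilla s x.1.1 y.1.1 * ebits c (x.1.2.1, x.2) (y.1.2.1, y.2) *
      σ x.1.2.2.1 y.1.2.2.1 * ρ x.1.2.2.2 y.1.2.2.2

/-- The action `ω ↦ (W ⊗ I) ω (W ⊗ I)†` of an operator on Alice's side. -/
def onAlice {A A' B : Type} [Fintype A] [Fintype B] [DecidableEq B]
    (W : Matrix A' A ℂ) (ω : Op (A × B)) : Op (A' × B) :=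
  (W ⊗ₖ (1 : Op B)) * ω * (W ⊗ₖ (1 : Op B)).conjTranspose

/-! ### Codes -/

/-- The encoding part of an entanglement-assisted operator code that encodes `k` logical qubits
into `n` qubits with `s` ancillas, `c` ebits and `r` gauge qubits: a unitary from Alice's register
onto the `n` qubits that she sends. -/
structure Encoding (n s c r k : ℕ) where
  V : Matrix (Q n) (Reg s c r k) ℂ
  mul_conjTranspose : V * V.conjTranspose = 1
  conjTranspose_mul : V.conjTranspose * V = 1

namespace Encoding

variable {n s c r k : ℕ} (C : Encoding n s c r k)

/-- The encoded state, on the `n` qubits sent by Alice and Bob's halves of the ebits, for the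
state `σ` of the gauge qubits and the state `ρ` of the logical qubits. -/
def encode (σ : Op (Q r)) (ρ : Op (Q k)) : Op (Q n × Q c) :=
  onAlice C.V (canonical s σ ρ)

/-- The encoding unitary takes the canonical generators to the given ones, up to a phase for each
generator. -/
structure DefinedBy (G : Generators n s c r) : Prop where
  isotropic_Z : ∀ i : Fin s, ∃ ω : ℂ, ‖ω‖ = 1 ∧
    C.V * (onQubit i sigmaZ ⊗ₖ ((1 : Op (Q c)) ⊗ₖ ((1 : Op (Q r)) ⊗ₖ (1 : Op (Q k))))) *
      C.V.conjTranspose = ω • toOp (G.Zbar (Sum.inl i))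
  entanglement_Z : ∀ j : Fin c, ∃ ω : ℂ, ‖ω‖ = 1 ∧
    C.V * ((1 : Op (Q s)) ⊗ₖ (onQubit j sigmaZ ⊗ₖ ((1 : Op (Q r)) ⊗ₖ (1 : Op (Q k))))) *
      C.V.conjTranspose = ω • toOp (G.Zbar (Sum.inr (Sum.inl j)))
  entanglement_X : ∀ j : Fin c, ∃ ω : ℂ, ‖ω‖ = 1 ∧
    C.V * ((1 : Op (Q s)) ⊗ₖ (onQubit j sigmaX ⊗ₖ ((1 : Op (Q r)) ⊗ₖ (1 : Op (Q k))))) *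
      C.V.conjTranspose = ω • toOp (G.Xbar (Sum.inl j))
  gauge_Z : ∀ l : Fin r, ∃ ω : ℂ, ‖ω‖ = 1 ∧
    C.V * ((1 : Op (Q s)) ⊗ₖ ((1 : Op (Q c)) ⊗ₖ (onQubit l sigmaZ ⊗ₖ (1 : Op (Q k))))) *
      C.V.conjTranspose = ω • toOp (G.Zbar (Sum.inr (Sum.inr l)))
  gauge_X : ∀ l : Fin r, ∃ ω : ℂ, ‖ω‖ = 1 ∧
    C.V * ((1 : Op (Q s)) ⊗ₖ ((1 : Op (Q c)) ⊗ₖ (onQubit l sigmaX ⊗ₖ (1 : Op (Q k))))) *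
      C.V.conjTranspose = ω • toOp (G.Xbar (Sum.inr l))

/-- The encoding together with the decoding map `D` corrects the error set `𝓔`: for each error,
which acts on the `n` transmitted qubits only, and each state of the gauge qubits, encoding,
error and decoding compose to the identity on the `k` logical qubits. -/
def Corrects (D : Op (Q n × Q c) →ₗ[ℂ] Op (Q k)) (𝓔 : Set (pauliGroup n)) : Prop :=
  ∀ E ∈ 𝓔, ∀ σ : Op (Q r), IsState σ → ∀ ρ : Op (Q k),
    D (onAlice (toOp E) (C.encode σ ρ)) = ρ

end Encoding

end EAOQ

end

/-! Existence of the encoding. Two Paulis commute up to a sign, and a Pauli that is not a phase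
anticommutes with some other Pauli, so it has trace zero (`trace_toOp`). The size hypothesis makes
the generators independent modulo phases (`Generators.exists_injective`), so every nontrivial
product of `Zbar`'s has trace zero. Averaging over the group that the `Zbar`'s generate, with
prescribed signs, therefore gives a projection of trace `2 ^ n / 2 ^ (s + c + r)`
(`exists_isometry_of_hom`). This forces `s + c + r ≤ n` and gives all joint eigenspaces the same
dimension `2 ^ k`. Each `Xbar j` flips one sign, so it permutes these eigenspaces; bases transported
along the `Xbar`'s are the columns of `V` (`Generators.exists_encoding`).

Correction. Encoding is conjugation by an isometry `J = (V ⊗ I)(|0⟩ ⊗ Φ ⊗ I ⊗ I)` of the gauge and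
logical qubits. Isotropic and gauge operators act on `J` through a unitary of the gauge factor alone
(`Encoding.DefinedBy.le_gaugeActing`). Isotropic generators, and entanglement generators paired with
a Pauli on the receiver's halves, fix `J` up to a phase. An error outside the centralizer
anticommutes with one of them, hence moves the range of `J` to an orthogonal space
(`Encoding.DefinedBy.orthogonal`). So errors in the same class modulo phases, isotropic and gauge
operators differ by a gauge unitary, and different classes have orthogonal ranges. Measuring the
class, undoing a representative and tracing out the gauge qubits recovers `ρ` (`exists_decoder`). -/

namespace EAOQ

/-! ### Signs and entries of one-qubit Pauli operators -/

/-- The sign `(-1) ^ b` of a bit. -/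
def sgn (b : Fin 2) : ℂ := (-1) ^ (b : ℕ)

theorem sgn_zero : sgn 0 = 1 := by simp [sgn]

theorem sgn_one : sgn 1 = -1 := by simp [sgn]

theorem sgn_add (a b : Fin 2) : sgn (a + b) = sgn a * sgn b := by
  fin_cases a <;> fin_cases b <;> simp [sgn]

theorem sgn_mul_self (a : Fin 2) : sgn a * sgn a = 1 := by
  fin_cases a <;> simp [sgn]

theorem sgn_mul_of_ne {a b : Fin 2} (h : a ≠ b) : sgn a * sgn b = -1 := by
  fin_cases a <;> fin_cases b <;> simp_all [sgn]

theorem star_sgn (a : Fin 2) : star (sgn a) = sgn a := by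
  simp [sgn]

theorem onQubit_apply {m : ℕ} (j : Fin m) (B : Op (Fin 2)) (x y : Q m) :
    onQubit j B x y = if ∀ i, i ≠ j → x i = y i then B (x j) (y j) else 0 := by
  have h : ∀ i, Function.update (fun _ => (1 : Op (Fin 2))) j B i (x i) (y i) =
      if i = j then B (x j) (y j) else if x i = y i then 1 else 0 := by
    intro i
    by_cases hi : i = j
    · subst hi; simp
    · simp [hi, Matrix.one_apply]
  simp only [onQubit, tensor, Matrix.of_apply, h]
  split_ifs with hxy
  · rw [Finset.prod_eq_single j] <;> simp +contextual [hxy]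
  · push Not at hxy
    obtain ⟨i, hi, hne⟩ := hxy
    exact Finset.prod_eq_zero (Finset.mem_univ i) (by simp [hi, hne])

theorem onQubit_sigmaZ {m : ℕ} (j : Fin m) :
    onQubit j sigmaZ = Matrix.diagonal fun x => sgn (x j) := by
  ext x y
  rw [onQubit_apply, Matrix.diagonal_apply]
  have hZ : ∀ a b, sigmaZ a b = if a = b then sgn a else 0 := by
    intro a b; fin_cases a <;> fin_cases b <;> simp [sigmaZ, sgn]
  rw [hZ, ← ite_and]
  congr 1
  simp only [eq_iff_iff, funext_iff]
  grind

theorem onQubit_sigmaX {m : ℕ} (j : Fin m) :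
    onQubit j sigmaX = Matrix.of fun x y => if x = y + Pi.single j 1 then 1 else 0 := by
  ext x y
  rw [onQubit_apply, Matrix.of_apply]
  have hX : ∀ a b, sigmaX a b = if a = b + 1 then 1 else 0 := by
    intro a b; fin_cases a <;> fin_cases b <;> simp [sigmaX]
  rw [hX, ← ite_and]
  congr 1
  simp only [eq_iff_iff, funext_iff, Pi.add_apply, Pi.single_apply]
  constructor
  · rintro ⟨h1, h2⟩ i
    by_cases hi : i = j
    · subst hi; simpa using h2
    · simpa [hi] using h1 i hi
  · exact fun h => ⟨fun i hi => by simpa [hi] using h i, by simpa using h j⟩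

theorem onQubit_transpose {m : ℕ} (j : Fin m) (B : Op (Fin 2)) :
    (onQubit j B).transpose = onQubit j B.transpose := by
  ext x y
  simp only [Matrix.transpose_apply, onQubit_apply]
  congr 1
  simp only [eq_comm]

/-- Vectors of bits are sums of unit vectors. -/
theorem bits_induction {ι : Type*} [Fintype ι] [DecidableEq ι] {p : (ι → Fin 2) → Prop}
    (zero : p 0) (add : ∀ a b, p a → p b → p (a + b)) (single : ∀ i, p (Pi.single i 1))
    (a : ι → Fin 2) : p a := by
  rw [← Finset.univ_sum_single a]
  refine Finset.sum_induction _ p add zero fun i _ => ?_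
  obtain h | h : a i = 0 ∨ a i = 1 := by have := a i; grind
  · rw [h, Pi.single_zero]; exact zero
  · rw [h]; exact single i

/-! ### Commutation in the Pauli group -/

section Sign

variable {A : Type*} [Fintype A]

/-- Two matrices commute up to a sign. -/
def CommSign (M N : Matrix A A ℂ) : Prop := M * N = N * M ∨ M * N = -(N * M)

theorem CommSign.symm {M N : Matrix A A ℂ} (h : CommSign M N) : CommSign N M := by
  rcases h with h | h
  · exact Or.inl h.symm
  · exact Or.inr (by rw [h, neg_neg])

theorem CommSign.mul {M M' N : Matrix A A ℂ} (h : CommSign M N) (h' : CommSign M' N) :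
    CommSign (M * M') N := by
  unfold CommSign
  rw [mul_assoc]
  rcases h with h | h <;> rcases h' with h' | h' <;> rw [h'] <;> simp [← mul_assoc, h]

theorem CommSign.inv [DecidableEq A] {g : Matrix.unitaryGroup A ℂ} {N : Matrix A A ℂ}
    (h : CommSign (g : Matrix A A ℂ) N) :
    CommSign ((g⁻¹ : Matrix.unitaryGroup A ℂ) : Matrix A A ℂ) N := by
  have h1 : ((g⁻¹ : Matrix.unitaryGroup A ℂ) : Matrix A A ℂ) * g = 1 := by
    rw [← Submonoid.coe_mul]; simp
  have h2 : (g : Matrix A A ℂ) * ((g⁻¹ : Matrix.unitaryGroup A ℂ) : Matrix A A ℂ) = 1 := by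
    rw [← Submonoid.coe_mul]; simp
  generalize ((g⁻¹ : Matrix.unitaryGroup A ℂ) : Matrix A A ℂ) = M at h1 h2
  have e : M * (N * (g : Matrix A A ℂ)) * M = M * N := by
    rw [mul_assoc, mul_assoc, h2, mul_one]
  have e' : M * ((g : Matrix A A ℂ) * N) * M = N * M := by
    rw [← mul_assoc, h1, one_mul]
  rcases h with h | h
  · left; rw [← e, ← e', h]
  · right; rw [← e, ← e', h]; simp

end Sign

/-- Commuting with a fixed `N` up to sign passes to products and inverses, so generators suffice.
`commSign_toOp` uses this once in each argument. -/
theorem commSign_of_mem_pauliGroup {n : ℕ} {N : Op (Q n)}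
    (hX : ∀ j, CommSign (onQubit j sigmaX) N) (hZ : ∀ j, CommSign (onQubit j sigmaZ) N)
    {g : Matrix.unitaryGroup (Q n) ℂ} (hg : g ∈ pauliGroup n) : CommSign (g : Op (Q n)) N := by
  induction hg using Subgroup.closure_induction with
  | mem g hg =>
    obtain (rfl | ⟨j, rfl⟩) | ⟨j, rfl⟩ := hg
    · left; simp [iOne]
    · exact hX j
    · exact hZ j
  | one => left; simp
  | mul g h _ _ hg hh => exact hg.mul hh
  | inv g _ hg => exact hg.inv

theorem onQubit_mul_comm {m : ℕ} (i j : Fin m) (B : Op (Fin 2)) :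
    onQubit i B * onQubit j B = onQubit j B * onQubit i B := by
  simp only [onQubit, tensor_mul]
  congr 1
  funext l
  by_cases h : l = i <;> by_cases h' : l = j <;> simp [Function.update_apply, h, h']

theorem sigmaX_mul_sigmaZ {m : ℕ} (i j : Fin m) :
    onQubit i sigmaX * onQubit j sigmaZ =
      (if i = j then -1 else 1 : ℂ) • (onQubit j sigmaZ * onQubit i sigmaX) := by
  rw [onQubit_sigmaX, onQubit_sigmaZ]
  ext x y
  rw [Matrix.mul_diagonal, Matrix.smul_apply, Matrix.diagonal_mul]
  simp only [Matrix.of_apply, smul_eq_mul]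
  by_cases h : x = y + Pi.single i 1
  · rw [if_pos h, h, Pi.add_apply, sgn_add]
    by_cases hij : i = j
    · subst hij; simp [sgn_one]
    · simp [hij, Ne.symm hij, sgn_zero]
  · simp [h]

theorem commSign_sigmaX_sigmaZ {m : ℕ} (i j : Fin m) :
    CommSign (onQubit i sigmaX) (onQubit j sigmaZ) := by
  unfold CommSign
  rw [sigmaX_mul_sigmaZ]
  split_ifs
  · right; simp
  · left; simp

theorem commSign_toOp {n : ℕ} (g h : pauliGroup n) : CommSign (toOp g) (toOp h) := by
  refine commSign_of_mem_pauliGroup (fun j => ?_) (fun j => ?_) g.2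
  · exact (commSign_of_mem_pauliGroup (fun i => Or.inl (onQubit_mul_comm _ _ _))
      (fun i => (commSign_sigmaX_sigmaZ _ _).symm) h.2).symm
  · exact (commSign_of_mem_pauliGroup (fun i => commSign_sigmaX_sigmaZ _ _)
      (fun i => Or.inl (onQubit_mul_comm _ _ _)) h.2).symm

theorem toOp_mul {n : ℕ} (g h : pauliGroup n) : toOp (g * h) = toOp g * toOp h := rfl

theorem toOp_one {n : ℕ} : toOp (1 : pauliGroup n) = 1 := rfl

theorem toOp_inv {n : ℕ} (g : pauliGroup n) : toOp g⁻¹ = (toOp g).conjTranspose := rfl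

theorem toOp_injective {n : ℕ} : Function.Injective (toOp (n := n)) :=
  fun _ _ h => Subtype.ext (Subtype.ext h)

theorem toOp_mem {n : ℕ} (g : pauliGroup n) : toOp g ∈ Matrix.unitaryGroup (Q n) ℂ :=
  (g : Matrix.unitaryGroup (Q n) ℂ).2

/-- Since `g` and `h` commute up to sign, `(g h)² = ± g² h²`, so the property passes to products. -/
theorem toOp_sq {n : ℕ} (g : pauliGroup n) : toOp g * toOp g = 1 ∨ toOp g * toOp g = -1 := by
  obtain ⟨g, hg⟩ := g
  induction hg using Subgroup.closure_induction with
  | mem g hg =>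
    obtain (rfl | ⟨j, rfl⟩) | ⟨j, rfl⟩ := hg
    · right
      change (Complex.I • (1 : Op (Q n))) * (Complex.I • (1 : Op (Q n))) = -1
      rw [smul_mul_smul_comm]; simp
    · left; exact onQubit_sq j sigmaX_sq
    · left; exact onQubit_sq j sigmaZ_sq
  | one => left; exact mul_one _
  | mul g h hg' hh' hg hh =>
    have e := commSign_toOp ⟨h, hh'⟩ ⟨g, hg'⟩
    change toOp (⟨g, hg'⟩ * ⟨h, hh'⟩) * toOp (⟨g, hg'⟩ * ⟨h, hh'⟩) = _ ∨
      toOp (⟨g, hg'⟩ * ⟨h, hh'⟩) * toOp (⟨g, hg'⟩ * ⟨h, hh'⟩) = _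
    generalize (⟨g, hg'⟩ : pauliGroup n) = g at *
    generalize (⟨h, hh'⟩ : pauliGroup n) = h at *
    rw [toOp_mul, mul_assoc, ← mul_assoc (toOp h)]
    have e2 : toOp g * (toOp g * toOp h * toOp h) = (toOp g * toOp g) * (toOp h * toOp h) := by
      simp only [mul_assoc]
    rcases e with e | e <;> rw [e] <;> rcases hg with hg | hg <;> rcases hh with hh | hh <;>
      simp [e2, hg, hh]
  | inv g hg' hg =>
    have : toOp (⟨g, hg'⟩⁻¹ : pauliGroup n) * toOp (⟨g, hg'⟩⁻¹ : pauliGroup n) =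
      star (toOp ⟨g, hg'⟩ * toOp ⟨g, hg'⟩) := (star_mul _ _).symm
    change toOp (⟨g, hg'⟩⁻¹ : pauliGroup n) * toOp (⟨g, hg'⟩⁻¹ : pauliGroup n) = _ ∨
      toOp (⟨g, hg'⟩⁻¹ : pauliGroup n) * toOp (⟨g, hg'⟩⁻¹ : pauliGroup n) = _
    rw [this]
    rcases hg with hg | hg <;> rw [hg] <;> simp

/-- Squares of Paulis are `±1`, hence `z² = ±1` and `z` is a power of `i`. -/
theorem toOp_phase {n : ℕ} {g : pauliGroup n} {z : ℂ} (h : toOp g = z • 1) : g ∈ phases n := by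
  have hz : z * z = 1 ∨ z * z = -1 := by
    have h2 := toOp_sq g
    rw [h, smul_mul_smul_comm, one_mul] at h2
    refine h2.imp (fun h => ?_) (fun h => ?_)
    · simpa using congrFun (congrFun h 0) 0
    · simpa using congrFun (congrFun h 0) 0
  have hk : ∃ k : ℕ, z = Complex.I ^ k := by
    rcases hz with hz | hz
    · rcases mul_self_eq_one_iff.1 hz with rfl | rfl
      · exact ⟨0, by simp⟩
      · exact ⟨2, by simp⟩
    · rw [← Complex.I_mul_I] at hz
      rcases mul_self_eq_mul_self_iff.1 hz with rfl | rfl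
      · exact ⟨1, by simp⟩
      · exact ⟨3, by rw [pow_succ, Complex.I_sq]; simp⟩
  obtain ⟨k, rfl⟩ := hk
  refine ⟨k, toOp_injective ?_⟩
  have : ∀ k : ℕ, toOp ((⟨iOne n, iOne_mem n⟩ : pauliGroup n) ^ k) =
      Complex.I ^ k • (1 : Op (Q n)) := by
    intro k
    induction k with
    | zero => simp [toOp_one]
    | succ k ih =>
      rw [pow_succ, toOp_mul, ih, pow_succ]
      change _ * (Complex.I • (1 : Op (Q n))) = _
      rw [smul_mul_smul_comm, one_mul]
  simpa [h] using this k

/-- Operators that commute with all `X` and all `Z` operators are scalars. -/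
theorem eq_smul_one_of_comm {n : ℕ} {M : Op (Q n)}
    (hX : ∀ j, onQubit j sigmaX * M = M * onQubit j sigmaX)
    (hZ : ∀ j, onQubit j sigmaZ * M = M * onQubit j sigmaZ) : M = M 0 0 • 1 := by
  -- Conjugation by `Z` on a qubit where `x` and `y` differ negates the entry; conjugation by the
  -- `X`'s translates the diagonal, which is therefore constant.
  have off : ∀ x y, x ≠ y → M x y = 0 := by
    intro x y hxy
    obtain ⟨j, hj⟩ := Function.ne_iff.1 hxy
    have h := congrFun (congrFun (hZ j) x) y
    rw [onQubit_sigmaZ, Matrix.diagonal_mul, Matrix.mul_diagonal] at h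
    have h2 := congrArg (sgn (x j) * ·) h
    simp only [← mul_assoc, sgn_mul_self, one_mul] at h2
    rw [mul_right_comm, sgn_mul_of_ne hj, neg_one_mul] at h2
    exact self_eq_neg.1 h2
  have diag : ∀ a x, M (x + a) (x + a) = M x x := by
    intro a
    induction a using bits_induction with
    | zero => simp
    | add a b ha hb => intro x; rw [← add_assoc, hb, ha]
    | single j =>
      intro x
      have h := congrFun (congrFun (hX j) (x + Pi.single j 1)) x
      rw [onQubit_sigmaX] at h
      simpa [Matrix.mul_apply] using h.symm
  ext x y
  by_cases hxy : x = y
  · subst hxy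
    simpa using diag x 0
  · simp [off x y hxy, hxy]

/-- Conjugation by the unitary `N` preserves the trace and sends `M` to `-M`. -/
theorem trace_eq_zero_of_anticomm {A : Type*} [Fintype A] [DecidableEq A] {M : Matrix A A ℂ}
    {N : Matrix A A ℂ} (hN : N * star N = 1) (h : N * M = -(M * N)) : M.trace = 0 := by
  have h2 : (N * M * star N).trace = M.trace := by
    rw [Matrix.trace_mul_comm, ← mul_assoc, mul_eq_one_comm.1 hN, one_mul]
  rw [h, Matrix.neg_mul, mul_assoc, hN, mul_one, Matrix.trace_neg] at h2
  exact self_eq_neg.1 h2.symm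

/-- With nonzero trace, `g` anticommutes with nothing, so it commutes with the whole Pauli group; it
is then a scalar, hence a phase. -/
theorem trace_toOp {n : ℕ} {g : pauliGroup n} (hg : g ∉ phases n) : (toOp g).trace = 0 := by
  by_contra ht
  have hcomm : ∀ h : pauliGroup n, toOp h * toOp g = toOp g * toOp h := by
    intro h
    refine (commSign_toOp h g).resolve_right fun h' => ht ?_
    exact trace_eq_zero_of_anticomm (Unitary.mul_star_self_of_mem (toOp_mem h)) h'
  refine hg (toOp_phase (eq_smul_one_of_comm (fun j => ?_) (fun j => ?_)))
  · exact hcomm ⟨pauliX j, Subgroup.subset_closure (Or.inl (Or.inr ⟨j, rfl⟩))⟩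
  · exact hcomm ⟨pauliZ j, Subgroup.subset_closure (Or.inr ⟨j, rfl⟩)⟩

theorem toOp_of_mem_phases {n : ℕ} {g : pauliGroup n} (hg : g ∈ phases n) :
    ∃ z : ℂ, ‖z‖ = 1 ∧ toOp g = z • 1 := by
  obtain ⟨k, rfl⟩ := hg
  induction k using Int.induction_on with
  | zero => exact ⟨1, by simp, by simp [toOp_one]⟩
  | succ k ih =>
    obtain ⟨z, hz, h⟩ := ih
    refine ⟨z * Complex.I, by simp [hz], ?_⟩
    simp only [zpow_add_one] at h ⊢
    rw [toOp_mul, h]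
    change _ * (Complex.I • (1 : Op (Q n))) = _
    rw [smul_mul_smul_comm, one_mul]
  | pred k ih =>
    obtain ⟨z, hz, h⟩ := ih
    refine ⟨z * star Complex.I, by simp [hz], ?_⟩
    simp only [zpow_sub_one] at h ⊢
    rw [toOp_mul, h]
    change _ * star (Complex.I • (1 : Op (Q n))) = _
    rw [star_smul, star_one, smul_mul_smul_comm, one_mul]

/-! ### Elementary abelian 2-groups of operators -/

/-- Commuting involutions generate a homomorphic image of the group of bit vectors. -/
theorem exists_bits_hom {M ι : Type*} [Monoid M] [Fintype ι] [DecidableEq ι] (z : ι → M)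
    (comm : ∀ i j, z i * z j = z j * z i) (sq : ∀ i, z i * z i = 1) :
    ∃ ζ : (ι → Fin 2) → M, ζ 0 = 1 ∧ (∀ a b, ζ (a + b) = ζ a * ζ b) ∧
      ∀ i, ζ (Pi.single i 1) = z i := by
  let φ : ι → Multiplicative (Fin 2) →* M := fun i =>
    { toFun := fun a => if a.toAdd = 0 then 1 else z i
      map_one' := by simp
      map_mul' := by
        intro a b
        obtain ⟨a, rfl⟩ := Multiplicative.ofAdd.surjective a
        obtain ⟨b, rfl⟩ := Multiplicative.ofAdd.surjective b
        fin_cases a <;> fin_cases b <;> simp [sq] }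
  have hφ : Pairwise fun i j => ∀ x y, Commute (φ i x) (φ j y) := by
    intro i j _ x y
    change (if _ then _ else _) * (if _ then _ else _) =
      (if _ then _ else _) * (if _ then _ else _)
    split_ifs <;> simp [comm i j]
  let F := MonoidHom.noncommPiCoprod φ hφ
  refine ⟨fun a => F fun i => Multiplicative.ofAdd (a i), ?_, fun a b => ?_, fun i => ?_⟩
  · exact map_one F
  · exact map_mul F _ _
  · have : (fun j => Multiplicative.ofAdd ((Pi.single i 1 : ι → Fin 2) j)) =
        Pi.mulSingle i (Multiplicative.ofAdd (1 : Fin 2)) := by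
      funext j
      by_cases h : j = i
      · subst h; simp
      · simp [h]
    change F _ = _
    rw [this, MonoidHom.noncommPiCoprod_mulSingle]
    simp [φ]

instance phases_normal (n : ℕ) : (phases n).Normal where
  conj_mem g hg h := by
    obtain ⟨z, -, hz⟩ := toOp_of_mem_phases hg
    refine toOp_phase (z := z) ?_
    rw [toOp_mul, toOp_mul, hz, mul_smul_comm, mul_one, smul_mul_assoc, ← toOp_mul,
      mul_inv_cancel, toOp_one]

theorem quotient_phases_comm {n : ℕ} (x y : pauliGroup n ⧸ phases n) : x * y = y * x := by
  induction x using QuotientGroup.induction_on with | H g =>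
  induction y using QuotientGroup.induction_on with | H h =>
  rw [← QuotientGroup.mk_mul, ← QuotientGroup.mk_mul, QuotientGroup.eq]
  have h1 : toOp (g * h)⁻¹ * toOp (g * h) = 1 := by rw [← toOp_mul, inv_mul_cancel, toOp_one]
  rcases commSign_toOp h g with e | e
  · refine toOp_phase (z := 1) ?_
    rw [toOp_mul, toOp_mul h g, e, ← toOp_mul g h, h1, one_smul]
  · refine toOp_phase (z := -1) ?_
    rw [toOp_mul, toOp_mul h g, e, ← toOp_mul g h, mul_neg, h1, neg_one_smul]

theorem quotient_phases_sq {n : ℕ} (x : pauliGroup n ⧸ phases n) : x * x = 1 := by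
  induction x using QuotientGroup.induction_on with | H g =>
  rw [← QuotientGroup.mk_mul, QuotientGroup.eq_one_iff]
  rcases toOp_sq g with e | e
  · exact toOp_phase (z := 1) (by rw [toOp_mul, e, one_smul])
  · exact toOp_phase (z := -1) (by rw [toOp_mul, e, neg_one_smul])

/-- The subgroup generated by commuting involutions is the image of the group of bit vectors. -/
theorem range_eq_closure {H ι : Type*} [Group H] [Fintype ι] [DecidableEq ι] {z : ι → H}
    {ζ : (ι → Fin 2) → H} (zero : ζ 0 = 1) (add : ∀ a b, ζ (a + b) = ζ a * ζ b)
    (single : ∀ i, ζ (Pi.single i 1) = z i) :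
    Set.range ζ = Subgroup.closure (Set.range z) := by
  have hinv : ∀ a, (ζ a)⁻¹ = ζ a := by
    intro a
    rw [inv_eq_iff_mul_eq_one, ← add, ← zero]
    congr 1
    funext i
    simp only [Pi.add_apply, Pi.zero_apply]
    have := a i
    grind
  apply Set.Subset.antisymm
  · rintro _ ⟨a, rfl⟩
    induction a using bits_induction with
    | zero => rw [zero]; exact one_mem _
    | add a b ha hb => rw [add]; exact mul_mem ha hb
    | single i => rw [single]; exact Subgroup.subset_closure ⟨i, rfl⟩
  · intro g hg
    induction hg using Subgroup.closure_induction with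
    | mem g hg => obtain ⟨i, rfl⟩ := hg; exact ⟨_, single i⟩
    | one => exact ⟨0, zero⟩
    | mul g h _ _ hg hh =>
      obtain ⟨a, rfl⟩ := hg
      obtain ⟨b, rfl⟩ := hh
      exact ⟨a + b, add a b⟩
    | inv g _ hg => obtain ⟨a, rfl⟩ := hg; exact ⟨a, (hinv a).symm⟩

/-- Modulo phases the Pauli group is generated by `2 n` commuting involutions. Finiteness is what
leaves the decoder with finitely many error classes. -/
instance phases_finiteIndex (n : ℕ) : (phases n).FiniteIndex := by
  obtain ⟨ζ, zero, add, single⟩ := exists_bits_hom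
    (fun j : Fin n ⊕ Fin n => QuotientGroup.mk' (phases n)
      (Sum.elim (fun j => ⟨pauliX j, Subgroup.subset_closure (Or.inl (Or.inr ⟨j, rfl⟩))⟩)
        (fun j => ⟨pauliZ j, Subgroup.subset_closure (Or.inr ⟨j, rfl⟩)⟩) j))
    (fun _ _ => quotient_phases_comm _ _) (fun _ => quotient_phases_sq _)
  have h : Set.range ζ = Set.univ := by
    rw [range_eq_closure zero add single, Set.eq_univ_iff_forall]
    intro x
    obtain ⟨⟨g, hg⟩, rfl⟩ := QuotientGroup.mk'_surjective _ x
    induction hg using Subgroup.closure_induction with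
    | mem g hg =>
      obtain (rfl | ⟨j, rfl⟩) | ⟨j, rfl⟩ := hg
      · have : QuotientGroup.mk' (phases n) ⟨iOne n, iOne_mem n⟩ = 1 :=
          (QuotientGroup.eq_one_iff _).2 (Subgroup.mem_zpowers _)
        rw [this]
        exact one_mem _
      · exact Subgroup.subset_closure ⟨Sum.inl j, rfl⟩
      · exact Subgroup.subset_closure ⟨Sum.inr j, rfl⟩
    | one => exact one_mem _
    | mul g h hg' hh' hg hh => exact mul_mem hg hh
    | inv g hg' hg => exact inv_mem hg
  have : Finite (pauliGroup n ⧸ phases n) :=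
    Set.finite_univ_iff.1 (h ▸ Set.finite_range ζ)
  exact Subgroup.finiteIndex_of_finite_quotient

namespace Generators

variable {n s c r : ℕ} (G : Generators n s c r)

/-- Modulo phases, the generators are independent. -/
theorem exists_injective : ∃ ζ : ((Fin s ⊕ (Fin c ⊕ Fin r)) ⊕ (Fin c ⊕ Fin r) → Fin 2) →
      pauliGroup n ⧸ phases n, Function.Injective ζ ∧ ζ 0 = 1 ∧
      (∀ a b, ζ (a + b) = ζ a * ζ b) ∧
      ∀ i, ζ (Pi.single i 1) = QuotientGroup.mk' (phases n) (Sum.elim G.Zbar G.Xbar i) := by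
  obtain ⟨ζ, zero, add, single⟩ := exists_bits_hom
    (fun i => QuotientGroup.mk' (phases n) (Sum.elim G.Zbar G.Xbar i))
    (fun _ _ => quotient_phases_comm _ _) (fun _ => quotient_phases_sq _)
  refine ⟨ζ, ?_, zero, add, single⟩
  have hr := range_eq_closure zero add single
  have hsize := G.size
  nth_rw 1 [← QuotientGroup.ker_mk' (phases n)] at hsize
  rw [Subgroup.relIndex_ker, MonoidHom.map_closure, ← Set.Sum.elim_range, ← Set.range_comp]
    at hsize
  have hcard : Nat.card (Set.range ζ) = 2 ^ (s + 2 * (c + r)) := by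
    rw [hr]; exact hsize
  -- `ζ` maps `2 ^ (s + 2 (c + r))` bit vectors onto a set of the same size, by the size hypothesis.
  have hb : Function.Bijective (Set.rangeFactorization ζ) := by
    rw [Nat.bijective_iff_surjective_and_card]
    refine ⟨Set.rangeFactorization_surjective, ?_⟩
    rw [hcard, Nat.card_eq_fintype_card]
    simp only [Fintype.card_pi, Finset.prod_const, Fintype.card_fin, Finset.card_univ,
      Fintype.card_sum]
    congr 1
    ring
  exact Set.rangeFactorization_injective.1 hb.1

/-- `ζ a` is a multiple of a Pauli whose class modulo phases has coordinates `(a, 0)`. By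
independence this class is trivial only for `a = 0`. The scalars `ω` leave room for the phases and
signs chosen below. -/
theorem trace_eq_zero {ω : Fin s ⊕ (Fin c ⊕ Fin r) → ℂ}
    {ζ : (Fin s ⊕ (Fin c ⊕ Fin r) → Fin 2) → Op (Q n)} (zero : ζ 0 = 1)
    (add : ∀ a b, ζ (a + b) = ζ a * ζ b)
    (single : ∀ i, ζ (Pi.single i 1) = ω i • toOp (G.Zbar i))
    {a : Fin s ⊕ (Fin c ⊕ Fin r) → Fin 2} (ha : a ≠ 0) : (ζ a).trace = 0 := by
  obtain ⟨η, inj, η0, ηadd, ηsingle⟩ := G.exists_injective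
  have key : ∀ a, ∃ (z : ℂ) (g : pauliGroup n), ζ a = z • toOp g ∧
      QuotientGroup.mk' (phases n) g = η (Sum.elim a 0) := by
    intro a
    induction a using bits_induction with
    | zero =>
      refine ⟨1, 1, by rw [zero, toOp_one, one_smul], ?_⟩
      rw [map_one, ← η0, Sum.elim_zero_zero]
    | add a b ha hb =>
      obtain ⟨z, g, h1, h2⟩ := ha
      obtain ⟨w, h, h3, h4⟩ := hb
      refine ⟨z * w, g * h, ?_, ?_⟩
      · rw [add, h1, h3, smul_mul_smul_comm, toOp_mul]
      · rw [map_mul, h2, h4, ← ηadd, ← Sum.elim_add_add, add_zero]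
    | single i =>
      refine ⟨ω i, G.Zbar i, single i, ?_⟩
      rw [Sum.elim_single_zero, ηsingle, Sum.elim_inl]
  obtain ⟨z, g, h1, h2⟩ := key a
  rw [h1, Matrix.trace_smul, trace_toOp, smul_zero]
  intro hg
  have : QuotientGroup.mk' (phases n) g = 1 := (QuotientGroup.eq_one_iff _).2 hg
  rw [this, ← η0] at h2
  refine ha (funext fun i => ?_)
  simpa using (congrFun (inj h2) (Sum.inl i)).symm

end Generators

/-! ### Joint eigenspaces -/

/-- The columns of `W` are an orthonormal basis of the range of `P`; the rank of an idempotent is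
its trace. -/
theorem exists_isometry_of_idempotent {A : Type*} [Fintype A] [DecidableEq A] {P : Matrix A A ℂ}
    (hP : P * P = P) : ∃ (d : ℕ) (W : Matrix A (Fin d) ℂ), (d : ℂ) = P.trace ∧
      W.conjTranspose * W = 1 ∧ P * W = W := by
  let f := Matrix.toLpLin 2 2 P
  have hf : LinearMap.IsProj (LinearMap.range f) f := by
    refine ⟨fun x => ⟨x, rfl⟩, ?_⟩
    rintro _ ⟨x, rfl⟩
    change (f * f) x = f x
    congr 1
    simp only [f, Module.End.mul_eq_comp, ← Matrix.toLpLin_mul, hP]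
  let b := stdOrthonormalBasis ℂ (LinearMap.range f)
  refine ⟨Module.finrank ℂ (LinearMap.range f), Matrix.of fun x i => (b i).1 x, ?_, ?_, ?_⟩
  · rw [← hf.trace]
    simp [f, Matrix.toLpLin_eq_toLin]
  · ext i j
    have := orthonormal_iff_ite.1 b.orthonormal i j
    rw [Matrix.one_apply, ← this]
    simp [Matrix.mul_apply, PiLp.inner_apply, mul_comm]
  · ext x i
    have h := congrArg (fun v => v x) (hf.map_id _ (b i).2)
    simpa [f, Matrix.toLpLin_apply, Matrix.mulVec, dotProduct, Matrix.mul_apply] using h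

/-- The average of the `ζ a` is an idempotent fixed by every `ζ a`. In its trace only `a = 0`
contributes, which gives the dimension. -/
theorem exists_isometry_of_hom {A ι : Type*} [Fintype A] [DecidableEq A] [Fintype ι]
    [DecidableEq ι] {ζ : (ι → Fin 2) → Matrix A A ℂ} (zero : ζ 0 = 1)
    (add : ∀ a b, ζ (a + b) = ζ a * ζ b) (tr : ∀ a, a ≠ 0 → (ζ a).trace = 0) :
    ∃ (d : ℕ) (W : Matrix A (Fin d) ℂ), d * 2 ^ Fintype.card ι = Fintype.card A ∧
      W.conjTranspose * W = 1 ∧ ∀ a, ζ a * W = W := by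
  set N : ℂ := 2 ^ Fintype.card ι with hN
  have hN0 : N ≠ 0 := by positivity
  let P : Matrix A A ℂ := N⁻¹ • ∑ a, ζ a
  have hζP : ∀ a, ζ a * P = P := by
    intro a
    simp only [P, mul_smul_comm, Finset.mul_sum, ← add]
    congr 1
    exact Fintype.sum_equiv (Equiv.addLeft a) _ _ fun _ => rfl
  have hP : P * P = P := by
    nth_rw 1 [show P = N⁻¹ • ∑ a, ζ a from rfl]
    rw [smul_mul_assoc, Finset.sum_mul]
    simp only [hζP, Finset.sum_const, Finset.card_univ, Fintype.card_pi, Finset.prod_const,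
      Fintype.card_fin, ← Nat.cast_smul_eq_nsmul ℂ, smul_smul]
    push_cast
    rw [← hN, inv_mul_cancel₀ hN0, one_smul]
  obtain ⟨d, W, hd, hW, hPW⟩ := exists_isometry_of_idempotent hP
  refine ⟨d, W, ?_, hW, fun a => ?_⟩
  · have : P.trace = N⁻¹ * Fintype.card A := by
      simp only [P, Matrix.trace_smul, Matrix.trace_sum, smul_eq_mul]
      rw [Finset.sum_eq_single 0 (fun a _ ha => tr a ha) (by simp), zero, Matrix.trace_one]
    rw [this] at hd
    have h2 : (d : ℂ) * N = Fintype.card A := by rw [hd]; field_simp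
    rw [hN] at h2
    exact_mod_cast h2
  · rw [← hPW, ← Matrix.mul_assoc, hζP]

theorem exists_involution {n : ℕ} (g : pauliGroup n) :
    ∃ ω : ℂ, ‖ω‖ = 1 ∧ (ω • toOp g) * (ω • toOp g) = 1 := by
  rcases toOp_sq g with h | h
  · exact ⟨1, by simp, by simpa using h⟩
  · exact ⟨Complex.I, by simp, by rw [smul_mul_smul_comm, h]; simp⟩

theorem smul_mem_unitaryGroup {A : Type*} [Fintype A] [DecidableEq A] {M : Matrix A A ℂ} {ω : ℂ}
    (hω : ‖ω‖ = 1) (hM : M ∈ Matrix.unitaryGroup A ℂ) : ω • M ∈ Matrix.unitaryGroup A ℂ := by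
  rw [Matrix.mem_unitaryGroup_iff] at hM ⊢
  rw [star_smul, smul_mul_smul_comm, hM, ← starRingEnd_apply, Complex.mul_conj,
    Complex.normSq_eq_norm_sq, hω]
  simp

namespace Generators

variable {n s c r : ℕ} (G : Generators n s c r)

/-- Multiplying each generator by its prescribed sign `sgn (b i)` turns the eigenspace for `b` into
a common fixed space. -/
theorem exists_eigenspaces {ω : Fin s ⊕ (Fin c ⊕ Fin r) → ℂ}
    (hω : ∀ i, (ω i • toOp (G.Zbar i)) * (ω i • toOp (G.Zbar i)) = 1) :
    ∃ k : ℕ, s + c + r + k = n ∧ ∀ b : Fin s ⊕ (Fin c ⊕ Fin r) → Fin 2,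
      ∃ W : Matrix (Q n) (Q k) ℂ, W.conjTranspose * W = 1 ∧
        ∀ i, (ω i • toOp (G.Zbar i)) * W = sgn (b i) • W := by
  have key : ∀ b : Fin s ⊕ (Fin c ⊕ Fin r) → Fin 2, ∃ (d : ℕ) (W : Matrix (Q n) (Fin d) ℂ),
      d * 2 ^ (s + c + r) = 2 ^ n ∧ W.conjTranspose * W = 1 ∧
        ∀ i, (ω i • toOp (G.Zbar i)) * W = sgn (b i) • W := by
    intro b
    obtain ⟨ζ, zero, add, single⟩ := exists_bits_hom
      (fun i => (sgn (b i) * ω i) • toOp (G.Zbar i))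
      (fun i j => by
        rw [smul_mul_smul_comm, smul_mul_smul_comm, G.comm_ZZ, mul_comm (sgn (b i) * ω i)])
      (fun i => by
        rw [mul_smul, smul_mul_smul_comm, hω, sgn_mul_self, one_smul])
    obtain ⟨d, W, hd, hW, h⟩ := exists_isometry_of_hom zero add
      (fun a ha => G.trace_eq_zero zero add single ha)
    refine ⟨d, W, ?_, hW, fun i => ?_⟩
    · simpa [add_assoc] using hd
    · have h1 := h (Pi.single i 1)
      rw [single, mul_smul, Matrix.smul_mul] at h1
      nth_rw 2 [← h1]
      rw [smul_smul, sgn_mul_self, one_smul]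
  -- Any sign pattern serves here: the dimension count shows that `2 ^ (s + c + r)` divides `2 ^ n`.
  obtain ⟨d, -, hd, -⟩ := key 0
  have hle : s + c + r ≤ n :=
    (Nat.pow_dvd_pow_iff_le_right (by norm_num : 1 < 2)).1 (Dvd.intro_left d hd)
  obtain ⟨k, hk⟩ := Nat.exists_eq_add_of_le hle
  refine ⟨k, hk.symm, fun b => ?_⟩
  obtain ⟨d, W, hd, hW, h⟩ := key b
  have hpos : 0 < 2 ^ (s + c + r) := by positivity
  have hd' : d = Fintype.card (Q k) := by
    rw [hk, pow_add 2 _ k, mul_comm] at hd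
    simpa using Nat.eq_of_mul_eq_mul_left hpos hd
  let e : Q k ≃ Fin d := (Fintype.equivFin (Q k)).trans (finCongr hd'.symm)
  refine ⟨W.submatrix id e, ?_, fun i => ?_⟩
  · rw [Matrix.conjTranspose_submatrix, ← Matrix.submatrix_mul _ _ _ id _ Function.bijective_id,
      hW, Matrix.submatrix_one_equiv]
  · change ((ω i • toOp (G.Zbar i)) * W).submatrix id e = (sgn (b i) • W).submatrix id e
    rw [h i]

/-- The joint eigenvectors of the `Z` generators, permuted by the `X` generators. -/
theorem exists_joint_eigenvectors : ∃ k : ℕ, s + c + r + k = n ∧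
    ∃ (U : (Fin s → Fin 2) → (Fin c ⊕ Fin r → Fin 2) → Matrix (Q n) (Q k) ℂ)
      (ω : Fin s ⊕ (Fin c ⊕ Fin r) → ℂ) (τ : Fin c ⊕ Fin r → ℂ),
      (∀ i, ‖ω i‖ = 1) ∧ (∀ i, ‖τ i‖ = 1) ∧
      (∀ a e, (U a e).conjTranspose * U a e = 1) ∧
      (∀ a e i, (ω i • toOp (G.Zbar i)) * U a e = sgn (Sum.elim a e i) • U a e) ∧
      ∀ a e j, (τ j • toOp (G.Xbar j)) * U a e = U a (e + Pi.single j 1) := by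
  choose ω hω hω2 using fun i => exists_involution (G.Zbar i)
  choose τ hτ hτ2 using fun j => exists_involution (G.Xbar j)
  obtain ⟨k, hk, h⟩ := G.exists_eigenspaces hω2
  choose W hW hWz using h
  obtain ⟨ξ, zero, add, single⟩ := exists_bits_hom (fun j => τ j • toOp (G.Xbar j))
    (fun i j => by rw [smul_mul_smul_comm, smul_mul_smul_comm, G.comm_XX, mul_comm (τ i)]) hτ2
  have unit : ∀ e, ξ e ∈ Matrix.unitaryGroup (Q n) ℂ := by
    intro e
    induction e using bits_induction with
    | zero => rw [zero]; exact one_mem _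
    | add a b ha hb => rw [add]; exact mul_mem ha hb
    | single j => rw [single]; exact smul_mem_unitaryGroup (hτ j) (toOp_mem _)
  have hcomm : ∀ (i : Fin s ⊕ (Fin c ⊕ Fin r)) (e : Fin c ⊕ Fin r → Fin 2),
      toOp (G.Zbar i) * ξ e = sgn (Sum.elim (0 : Fin s → Fin 2) e i) • (ξ e * toOp (G.Zbar i)) := by
    intro i e
    induction e using bits_induction with
    | zero => simp [zero, sgn_zero]
    | add a b ha hb =>
      have : sgn (Sum.elim (0 : Fin s → Fin 2) (a + b) i) =
          sgn (Sum.elim (0 : Fin s → Fin 2) a i) * sgn (Sum.elim (0 : Fin s → Fin 2) b i) := by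
        cases i
        · simp [sgn_zero]
        · simp [sgn_add]
      rw [this, add, ← mul_assoc, ha, smul_mul_assoc, mul_assoc, hb, mul_smul_comm, smul_smul,
        mul_assoc]
    | single j =>
      rw [single, mul_smul_comm, smul_mul_assoc, smul_comm (sgn _)]
      congr 1
      by_cases hij : i = Sum.inr j
      · subst hij
        rw [G.anticomm]
        simp [sgn_one]
      · rw [G.comm_XZ j i hij]
        cases i with
        | inl i => simp [sgn_zero]
        | inr i => rw [Sum.elim_inr, Pi.single_eq_of_ne (fun h => hij (congrArg _ h)), sgn_zero, one_smul]
  -- Only the bases with `e = 0` are chosen freely. The others are their translates by products of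
  -- `Xbar`'s; independent choices would not be permuted by the `Xbar`'s.
  refine ⟨k, hk, fun a e => ξ e * W (Sum.elim a 0), ω, τ, hω, hτ, fun a e => ?_, fun a e i => ?_,
    fun a e j => ?_⟩
  · have := Unitary.star_mul_self_of_mem (unit e)
    rw [Matrix.star_eq_conjTranspose] at this
    rw [Matrix.conjTranspose_mul, Matrix.mul_assoc, ← Matrix.mul_assoc _ (ξ e), this,
      Matrix.one_mul, hW]
  · have h1 : ω i • toOp (G.Zbar i) * ξ e =
        sgn (Sum.elim (0 : Fin s → Fin 2) e i) • (ξ e * (ω i • toOp (G.Zbar i))) := by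
      rw [smul_mul_assoc, hcomm, smul_comm, mul_smul_comm]
    rw [← Matrix.mul_assoc, h1, Matrix.smul_mul, Matrix.mul_assoc, hWz, Matrix.mul_smul, smul_smul]
    congr 1
    cases i <;> simp [sgn_zero]
  · beta_reduce
    rw [← Matrix.mul_assoc, add_comm, add, single]

/-- The encoding unitary exists. -/
theorem exists_encoding : ∃ k : ℕ, s + c + r + k = n ∧
    ∃ C : Encoding n s c r k, C.DefinedBy G := by
  obtain ⟨k, hk, U, ω, τ, hω, hτ, hU, hZ, hX⟩ := G.exists_joint_eigenvectors
  -- Some `Zbar i`, rescaled, has opposite eigenvalues on the two blocks; as a unitary it preserves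
  -- their inner products, which it also negates.
  have orth : ∀ a e a' e', (a, e) ≠ (a', e') → (U a e).conjTranspose * U a' e' = 0 := by
    intro a e a' e' hne
    obtain ⟨i, hi⟩ : ∃ i, Sum.elim a e i ≠ Sum.elim a' e' i := by
      rw [← Function.ne_iff]
      exact fun h => hne (by simpa [Sum.elim_eq_iff] using h)
    have hu := Unitary.star_mul_self_of_mem (smul_mem_unitaryGroup (hω i) (toOp_mem (G.Zbar i)))
    rw [Matrix.star_eq_conjTranspose] at hu
    have h : (U a e).conjTranspose * U a' e' = -((U a e).conjTranspose * U a' e') := by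
      calc (U a e).conjTranspose * U a' e'
          = ((ω i • toOp (G.Zbar i)) * U a e).conjTranspose *
              ((ω i • toOp (G.Zbar i)) * U a' e') := by
            rw [Matrix.conjTranspose_mul, Matrix.mul_assoc, ← Matrix.mul_assoc _ _ (U a' e'), hu,
              Matrix.one_mul]
        _ = _ := by
            rw [hZ, hZ, Matrix.conjTranspose_smul, Matrix.smul_mul, Matrix.mul_smul, smul_smul,
              star_sgn, sgn_mul_of_ne hi, neg_one_smul]
    ext x y
    exact self_eq_neg.1 (congrFun (congrFun h x) y)
  let V : Matrix (Q n) (Reg s c r k) ℂ :=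
    Matrix.of fun x y => U y.1 (Sum.elim y.2.1 y.2.2.1) x y.2.2.2
  have hVV : V.conjTranspose * V = 1 := by
    ext ⟨a, e, g, l⟩ ⟨a', e', g', l'⟩
    change ((U a (Sum.elim e g)).conjTranspose * U a' (Sum.elim e' g')) l l' = _
    by_cases h : (a, Sum.elim e g) = (a', Sum.elim e' g')
    · obtain ⟨rfl, h⟩ := Prod.ext_iff.1 h
      obtain ⟨rfl, rfl⟩ : e = e' ∧ g = g' := by simpa [Sum.elim_eq_iff] using h
      rw [hU]
      simp [Matrix.one_apply]
    · rw [orth _ _ _ _ h, Matrix.one_apply_ne]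
      · rfl
      · intro h'
        simp only [Prod.mk.injEq] at h'
        obtain ⟨rfl, rfl, rfl, rfl⟩ := h'
        exact h rfl
  -- Equal dimensions turn the isometry `V` into a unitary.
  have hcard : Fintype.card (Q n) = Fintype.card (Reg s c r k) := by
    simp [← hk, pow_add, mul_assoc]
  have hVV' : V * V.conjTranspose = 1 := (Matrix.mul_eq_one_comm_of_card_eq _ _ _ hcard.symm).1 hVV
  have intertwine : ∀ (B : Op (Reg s c r k)) (z : ℂ) (N : Op (Q n)), ‖z‖ = 1 →
      V * B = (z • N) * V → ∃ ω : ℂ, ‖ω‖ = 1 ∧ V * B * V.conjTranspose = ω • N := by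
    intro B z N hz h
    exact ⟨z, hz, by rw [h, Matrix.mul_assoc, hVV', Matrix.mul_one]⟩
  have hVZ : ∀ i x y, ((ω i • toOp (G.Zbar i)) * V) x y =
      sgn (Sum.elim y.1 (Sum.elim y.2.1 y.2.2.1) i) * V x y := fun i x y =>
    congrFun (congrFun (hZ y.1 (Sum.elim y.2.1 y.2.2.1) i) x) y.2.2.2
  have hVX : ∀ j x y, ((τ j • toOp (G.Xbar j)) * V) x y =
      U y.1 (Sum.elim y.2.1 y.2.2.1 + Pi.single j 1) x y.2.2.2 := fun j x y =>
    congrFun (congrFun (hX y.1 (Sum.elim y.2.1 y.2.2.1) j) x) y.2.2.2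
  have perm : ∀ (B : Op (Reg s c r k)) (f : Reg s c r k → Reg s c r k),
      (∀ x y, B x y = if x = f y then 1 else 0) → ∀ x y, (V * B) x y = V x (f y) := by
    intro B f h x y
    simp [Matrix.mul_apply, h]
  refine ⟨k, hk, ⟨V, hVV', hVV⟩, ⟨fun i => ?_, fun j => ?_, fun j => ?_, fun l => ?_, fun l => ?_⟩⟩
  · refine intertwine _ (ω (Sum.inl i)) _ (hω _) ?_
    ext x y
    rw [hVZ]
    simp only [onQubit_sigmaZ, ← Matrix.diagonal_one, Matrix.diagonal_kronecker_diagonal,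
      Matrix.mul_diagonal]
    simp [mul_comm]
  · refine intertwine _ (ω (Sum.inr (Sum.inl j))) _ (hω _) ?_
    ext x y
    rw [hVZ]
    simp only [onQubit_sigmaZ, ← Matrix.diagonal_one, Matrix.diagonal_kronecker_diagonal,
      Matrix.mul_diagonal]
    simp [mul_comm]
  · refine intertwine _ (τ (Sum.inl j)) _ (hτ _) ?_
    ext x y
    rw [hVX, perm _ fun y => (y.1, y.2.1 + Pi.single j 1, y.2.2)]
    · simp only [V, Matrix.of_apply]
      rw [← Sum.elim_single_zero, ← Sum.elim_add_add, add_zero]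
    · rintro ⟨a, e, g, l⟩ ⟨a', e', g', l'⟩
      simp [onQubit_sigmaX, Matrix.one_apply, ← ite_and]
      grind
  · refine intertwine _ (ω (Sum.inr (Sum.inr l))) _ (hω _) ?_
    ext x y
    rw [hVZ]
    simp only [onQubit_sigmaZ, ← Matrix.diagonal_one, Matrix.diagonal_kronecker_diagonal,
      Matrix.mul_diagonal]
    simp [mul_comm]
  · refine intertwine _ (τ (Sum.inr l)) _ (hτ _) ?_
    ext x y
    rw [hVX, perm _ fun y => (y.1, y.2.1, y.2.2.1 + Pi.single l 1, y.2.2.2)]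
    · simp only [V, Matrix.of_apply]
      rw [← Sum.elim_zero_single, ← Sum.elim_add_add, add_zero]
    · rintro ⟨a, e, g, l⟩ ⟨a', e', g', l'⟩
      simp [onQubit_sigmaX, Matrix.one_apply, ← ite_and]
      grind

end Generators

/-! ### Decoding mutually orthogonal isometries -/

theorem isChannel_of_kraus {A B I : Type} [Fintype A] [DecidableEq A] [Fintype B] [Fintype I]
    (K : I → Matrix B A ℂ) (hK : ∑ i, (K i).conjTranspose * K i = 1) :
    ∃ D : Op A →ₗ[ℂ] Op B, IsChannel D ∧ ∀ ρ, D ρ = ∑ i, K i * ρ * (K i).conjTranspose := by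
  let D : Op A →ₗ[ℂ] Op B :=
    { toFun := fun ρ => ∑ i, K i * ρ * (K i).conjTranspose
      map_add' := fun ρ τ => by simp only [Matrix.mul_add, Matrix.add_mul, Finset.sum_add_distrib]
      map_smul' := fun z ρ => by
        simp only [Matrix.mul_smul, Matrix.smul_mul, Finset.smul_sum, RingHom.id_apply] }
  let e := Fintype.equivFin I
  refine ⟨D, ⟨Fintype.card I, fun i => K (e.symm i), ?_, fun ρ => ?_⟩, fun ρ => rfl⟩
  · rw [← hK]
    exact Equiv.sum_comp e.symm fun i => (K i).conjTranspose * K i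
  · exact (Equiv.sum_comp e.symm fun i => K i * ρ * (K i).conjTranspose).symm

/-- The operator `⟨g| ⊗ I`. -/
def bra {R : Type} (K : Type) [DecidableEq R] [DecidableEq K] (g : R) : Matrix K (R × K) ℂ :=
  Matrix.of fun l p => if p = (g, l) then 1 else 0

theorem bra_mul_mul {R K : Type} [Fintype R] [Fintype K] [DecidableEq R] [DecidableEq K] (g : R)
    (τ : Op R) (ρ : Op K) :
    bra K g * (τ ⊗ₖ ρ) * (bra K g).conjTranspose =
      τ g g • ρ := by
  ext l l'
  simp [bra, Matrix.mul_apply, Matrix.kroneckerMap_apply, apply_ite star]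

theorem sum_bra {R K : Type} [Fintype R] [Fintype K] [DecidableEq R] [DecidableEq K] :
    ∑ g : R, (bra K g).conjTranspose * bra K g = 1 := by
  ext ⟨g, l⟩ ⟨g', l'⟩
  simp only [bra, Matrix.sum_apply, Matrix.mul_apply, Matrix.conjTranspose_apply, Matrix.of_apply,
    Prod.mk.injEq, Matrix.one_apply, apply_ite star, star_one, star_zero, mul_ite, mul_one,
    mul_zero, ite_and]
  simp

/-- Isometries with mutually orthogonal ranges have a common decoder. -/
theorem exists_decoder {H R K T : Type} [Fintype H] [DecidableEq H] [Fintype R] [DecidableEq R]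
    [Fintype K] [DecidableEq K] [Inhabited K] [Finite T] (M : T → Matrix H (R × K) ℂ)
    (iso : ∀ t, (M t).conjTranspose * M t = 1)
    (orth : ∀ t t', t ≠ t' → (M t).conjTranspose * M t' = 0) :
    ∃ D : Op H →ₗ[ℂ] Op K, IsChannel D ∧ ∀ t (τ : Op R) (ρ : Op K), τ.trace = 1 →
      D (M t * (τ ⊗ₖ ρ) * (M t).conjTranspose) = ρ := by
  classical
  have := Fintype.ofFinite T
  -- `P` projects onto the sum of the ranges of the `M t`.
  let P : Matrix H H ℂ := ∑ t, M t * (M t).conjTranspose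
  have hPM : ∀ t, P * M t = M t := by
    intro t
    simp only [P, Matrix.sum_mul, Matrix.mul_assoc]
    rw [Finset.sum_eq_single t (fun t' _ h => by rw [orth t' t h, Matrix.mul_zero]) (by simp), iso,
      Matrix.mul_one]
  have hPP : P * P = P := by
    nth_rw 2 [show P = ∑ t, M t * (M t).conjTranspose from rfl]
    simp only [Finset.mul_sum, ← Matrix.mul_assoc, hPM]
    rfl
  have hPs : P.conjTranspose = P := by
    simp [P, Matrix.conjTranspose_sum]
  -- The first family undoes `M t` and traces out `R`. The second sends the complement of `P` to a
  -- default state, only to make the map trace preserving.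
  let K' : (T × R) ⊕ H → Matrix K H ℂ := Sum.elim (fun p => bra K p.2 * (M p.1).conjTranspose)
    (fun y => Matrix.single (default : K) y (1 : ℂ) * (1 - P))
  obtain ⟨D, hD, h⟩ := isChannel_of_kraus K' (by
    rw [Fintype.sum_sum_type]
    simp only [K', Sum.elim_inl, Sum.elim_inr, Fintype.sum_prod_type]
    have h1 : ∀ t, ∑ g : R, (bra K g * (M t).conjTranspose).conjTranspose *
        (bra K g * (M t).conjTranspose) = M t * (M t).conjTranspose := by
      intro t
      simp only [Matrix.conjTranspose_mul, Matrix.conjTranspose_conjTranspose, Matrix.mul_assoc]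
      rw [← Matrix.mul_sum]
      simp only [← Matrix.mul_assoc (bra K _).conjTranspose]
      rw [← Matrix.sum_mul, sum_bra, Matrix.one_mul]
    have h2 : ∀ y : H, (Matrix.single (default : K) y (1 : ℂ) * (1 - P)).conjTranspose *
        (Matrix.single (default : K) y (1 : ℂ) * (1 - P)) =
        (1 - P) * Matrix.single y y 1 * (1 - P) := by
      intro y
      rw [Matrix.conjTranspose_mul, Matrix.conjTranspose_sub, hPs, Matrix.conjTranspose_one,
        Matrix.conjTranspose_single, star_one, Matrix.mul_assoc, ← Matrix.mul_assoc (.single _ _ _),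
        Matrix.single_mul_single_same, mul_one, ← Matrix.mul_assoc]
    have h3 : ∑ y : H, Matrix.single y y (1 : ℂ) = 1 := by
      ext a b
      simp [Matrix.sum_apply, Matrix.single_apply, Matrix.one_apply, ite_and]
    simp only [h1, h2]
    rw [← Finset.sum_mul, ← Finset.mul_sum, h3, mul_one]
    change P + _ = 1
    rw [mul_sub, sub_mul, sub_mul, hPP]
    simp)
  refine ⟨D, hD, fun t τ ρ hτ => ?_⟩
  rw [h, Fintype.sum_sum_type]
  have hz : ∀ y, K' (Sum.inr y) * M t = 0 := by
    intro y
    simp only [K', Sum.elim_inr]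
    rw [Matrix.mul_assoc, Matrix.sub_mul, hPM, Matrix.one_mul, sub_self, Matrix.mul_zero]
  have hd : ∀ t' g, K' (Sum.inl (t', g)) * M t = if t' = t then bra K g else 0 := by
    intro t' g
    simp only [K', Sum.elim_inl]
    rw [Matrix.mul_assoc]
    split_ifs with htt
    · rw [htt, iso, Matrix.mul_one]
    · rw [orth _ _ htt, Matrix.mul_zero]
  have hsandwich : ∀ i, K' i * (M t * (τ ⊗ₖ ρ) * (M t).conjTranspose) * (K' i).conjTranspose =
      (K' i * M t) * (τ ⊗ₖ ρ) * (K' i * M t).conjTranspose := by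
    intro i
    simp only [Matrix.conjTranspose_mul, Matrix.mul_assoc]
  simp only [hsandwich, hz, hd, Fintype.sum_prod_type, Matrix.zero_mul, Finset.sum_const_zero,
    add_zero]
  rw [Finset.sum_eq_single t (fun t' _ h => by simp [h]) (by simp)]
  simp only [if_true, bra_mul_mul]
  rw [← Finset.sum_smul]
  change τ.trace • ρ = ρ
  rw [hτ, one_smul]

/-! ### The canonical code -/

/-- The isometry `|0⟩ ⊗ Φ ⊗ I ⊗ I` of the gauge and logical qubits into the whole register. -/
noncomputable def canonicalIsometry (s c r k : ℕ) : Matrix (Reg s c r k × Q c) (Q r × Q k) ℂ :=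
  Matrix.of fun x p =>
    if x.1.1 = 0 then ebitKet c (x.1.2.1, x.2) * (1 : Op (Q r × Q k)) x.1.2.2 p else 0

theorem canonical_eq {s c r k : ℕ} (σ : Op (Q r)) (ρ : Op (Q k)) :
    (canonical s σ ρ : Op (Reg s c r k × Q c)) =
      canonicalIsometry s c r k * (σ ⊗ₖ ρ) * (canonicalIsometry s c r k).conjTranspose := by
  ext ⟨⟨a, e, g, l⟩, b⟩ ⟨⟨a', e', g', l'⟩, b'⟩
  have h1 : ∀ q, (canonicalIsometry s c r k * (σ ⊗ₖ ρ)) ((a, e, g, l), b) q =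
      if a = 0 then ebitKet c (e, b) * (σ g q.1 * ρ l q.2) else 0 := by
    intro q
    by_cases ha : a = 0 <;>
      simp [canonicalIsometry, Matrix.mul_apply, ha, Matrix.one_apply, Matrix.kroneckerMap_apply]
  rw [Matrix.mul_apply]
  simp only [h1]
  by_cases ha : a = 0 <;> by_cases ha' : a' = 0 <;>
    simp [canonicalIsometry, canonical, ancilla, ebits, Matrix.vecMulVec_apply, ha, ha',
      Matrix.single_apply, Matrix.one_apply, Ne.symm, apply_ite star]
  ring

theorem ebitKet_sq {c : ℕ} (e b : Q c) :
    star (ebitKet c (e, b)) * ebitKet c (e, b) = if e = b then (2 ^ c)⁻¹ else 0 := by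
  unfold ebitKet
  split_ifs
  · have h : ((Real.sqrt 2 ^ c) * (Real.sqrt 2 ^ c) : ℝ) = 2 ^ c := by
      rw [← mul_pow, Real.mul_self_sqrt (by norm_num)]
    rw [star_inv₀, ← mul_inv, ← starRingEnd_apply, Complex.conj_ofReal, ← Complex.ofReal_mul, h]
    simp
  · simp

theorem canonicalIsometry_isometry (s c r k : ℕ) :
    (canonicalIsometry s c r k).conjTranspose * canonicalIsometry s c r k = 1 := by
  ext p q
  rw [Matrix.mul_apply, Fintype.sum_prod_type]
  simp only [Fintype.sum_prod_type (α₁ := Q s), Fintype.sum_prod_type (α₁ := Q c)]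
  rw [Finset.sum_eq_single 0 (fun a _ ha => by simp [canonicalIsometry, ha]) (by simp)]
  have h : ∀ (e : Q c) (x : Q r × Q k) (b : Q c),
      (canonicalIsometry s c r k).conjTranspose p ((0, e, x), b) *
        canonicalIsometry s c r k ((0, e, x), b) q =
      (if e = b then (2 ^ c)⁻¹ else 0) *
        ((1 : Op (Q r × Q k)) p x * (1 : Op (Q r × Q k)) x q) := by
    intro e x b
    rw [← ebitKet_sq]
    simp only [canonicalIsometry, Matrix.conjTranspose_apply, Matrix.of_apply, if_true, star_mul']
    rw [mul_mul_mul_comm]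
    congr 2
    simp [Matrix.one_apply, eq_comm, apply_ite star]
  simp only [h, ← Finset.sum_mul, Finset.sum_ite_eq, Finset.mem_univ, if_true]
  rw [Finset.sum_const]
  simp only [← Finset.mul_sum]
  rw [← Matrix.mul_apply, mul_one]
  simp

/-- The canonical code space is preserved by stabilizers and gauge operators. -/
theorem kronecker_mul_canonicalIsometry {s c r k : ℕ} {S : Op (Q s)} {B B' : Op (Q c)}
    (A : Op (Q r)) (hS : ∀ x, S x 0 = if x = 0 then 1 else 0) (hB : B * B'.transpose = 1) :
    ((S ⊗ₖ (B ⊗ₖ (A ⊗ₖ (1 : Op (Q k))))) ⊗ₖ B') * canonicalIsometry s c r k =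
      canonicalIsometry s c r k * (A ⊗ₖ (1 : Op (Q k))) := by
  ext ⟨⟨a, e, x⟩, b⟩ p
  rw [Matrix.mul_apply, Matrix.mul_apply, Fintype.sum_prod_type]
  simp only [Fintype.sum_prod_type (α₁ := Q s), Fintype.sum_prod_type (α₁ := Q c)]
  rw [Finset.sum_eq_single 0 (fun a _ ha => by simp [canonicalIsometry, ha]) (by simp)]
  -- On ebits `B ⊗ B'` acts as `B B'ᵀ ⊗ I`, so `hB` says that the pair fixes `Φ`.
  have hb : ∑ e', B e e' * B' b e' = if e = b then 1 else 0 := by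
    rw [← Matrix.one_apply, ← hB]
    rfl
  obtain ⟨g, l⟩ := x
  obtain ⟨g', l'⟩ := p
  set κ : ℂ := ((Real.sqrt 2 ^ c : ℝ) : ℂ)⁻¹
  have hκ : ∀ e b : Q c, ebitKet c (e, b) = κ * if e = b then 1 else 0 := fun e b => by
    rw [mul_ite, mul_one, mul_zero]; rfl
  by_cases ha : a = 0
  · calc _ = ∑ e', (B e e' * B' b e') * (κ * (A g g' * (1 : Op (Q k)) l l')) := by
          refine Finset.sum_congr rfl fun e' _ => ?_
          simp only [canonicalIsometry, Matrix.of_apply, if_true, Matrix.kroneckerMap_apply, hS,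
            hκ, if_pos ha]
          rw [Finset.sum_eq_single (g', l') (fun x _ hx => by simp [Matrix.one_apply, hx])
            (by simp), Finset.sum_eq_single e' (fun x _ hx => by simp [hx.symm]) (by simp)]
          simp only [Matrix.one_apply_eq, if_true]
          ring
      _ = _ := by
          rw [← Finset.sum_mul, hb, Finset.sum_eq_single (g, l)
            (fun x _ hx => by simp [canonicalIsometry, Matrix.one_apply, hx.symm]) (by simp)]
          simp only [canonicalIsometry, Matrix.of_apply, if_pos ha, Matrix.kroneckerMap_apply, hκ,
            Matrix.one_apply_eq]
          ring
  · simp [canonicalIsometry, Matrix.kroneckerMap_apply, hS, ha]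

/-! ### Encoded errors -/

theorem kronecker_one_mul {A B C D : Type} [Fintype B] [Fintype D] [DecidableEq D]
    (M : Matrix A B ℂ) (N : Matrix B C ℂ) :
    (M * N) ⊗ₖ (1 : Op D) = (M ⊗ₖ (1 : Op D)) * (N ⊗ₖ (1 : Op D)) := by
  rw [← Matrix.mul_kronecker_mul, Matrix.one_mul]

theorem kronecker_one_conjTranspose {A B D : Type} [DecidableEq D] (M : Matrix A B ℂ) :
    (M ⊗ₖ (1 : Op D)).conjTranspose = M.conjTranspose ⊗ₖ (1 : Op D) := by
  rw [Matrix.conjTranspose_kronecker, Matrix.conjTranspose_one]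

namespace Encoding

variable {n s c r k : ℕ} (C : Encoding n s c r k)

/-- The isometry that encodes gauge and logical qubits. -/
noncomputable def isometry : Matrix (Q n × Q c) (Q r × Q k) ℂ :=
  (C.V ⊗ₖ (1 : Op (Q c))) * canonicalIsometry s c r k

theorem isometry_isometry : C.isometry.conjTranspose * C.isometry = 1 := by
  have hV : (C.V.conjTranspose * C.V) ⊗ₖ (1 : Op (Q c)) = 1 := by
    rw [C.conjTranspose_mul]
    ext x y
    simp [Matrix.kroneckerMap_apply, Matrix.one_apply, Prod.ext_iff, ← ite_and, and_comm]
  rw [isometry, Matrix.conjTranspose_mul, kronecker_one_conjTranspose, Matrix.mul_assoc,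
    ← Matrix.mul_assoc (C.V.conjTranspose ⊗ₖ (1 : Op (Q c))), ← kronecker_one_mul, hV,
    Matrix.one_mul, canonicalIsometry_isometry]

theorem encode_eq (σ : Op (Q r)) (ρ : Op (Q k)) :
    C.encode σ ρ = C.isometry * (σ ⊗ₖ ρ) * C.isometry.conjTranspose := by
  rw [encode, onAlice, canonical_eq, isometry, Matrix.conjTranspose_mul]
  simp only [Matrix.mul_assoc]

theorem onAlice_encode (E : Op (Q n)) (σ : Op (Q r)) (ρ : Op (Q k)) :
    onAlice E (C.encode σ ρ) = ((E ⊗ₖ (1 : Op (Q c))) * C.isometry) * (σ ⊗ₖ ρ) *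
      ((E ⊗ₖ (1 : Op (Q c))) * C.isometry).conjTranspose := by
  rw [encode_eq, onAlice, Matrix.conjTranspose_mul]
  simp only [Matrix.mul_assoc]

/-- Encoded stabilizers and gauge operators act on the gauge qubits. -/
theorem kronecker_mul_isometry {S : Op (Q s)} {B B' : Op (Q c)} {A : Op (Q r)} {ω : ℂ}
    {M : Op (Q n)} (hω : ‖ω‖ = 1)
    (h : C.V * (S ⊗ₖ (B ⊗ₖ (A ⊗ₖ (1 : Op (Q k))))) * C.V.conjTranspose = ω • M)
    (hS : ∀ x, S x 0 = if x = 0 then 1 else 0) (hB : B * B'.transpose = 1) :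
    (M ⊗ₖ B') * C.isometry = star ω • (C.isometry * (A ⊗ₖ (1 : Op (Q k)))) := by
  have hM : M * C.V = star ω • (C.V * (S ⊗ₖ (B ⊗ₖ (A ⊗ₖ (1 : Op (Q k)))))) := by
    have h1 : star ω * ω = 1 := by
      rw [← starRingEnd_apply, Complex.conj_mul', hω]; simp
    rw [← one_smul ℂ M, ← h1, mul_smul, ← h, Matrix.smul_mul, Matrix.mul_assoc _ _ C.V,
      C.conjTranspose_mul, Matrix.mul_one]
  rw [isometry, ← Matrix.mul_assoc, ← Matrix.mul_kronecker_mul, hM, Matrix.mul_one,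
    Matrix.smul_kronecker, Matrix.smul_mul, Matrix.mul_assoc,
    ← kronecker_mul_canonicalIsometry A hS hB, ← Matrix.mul_assoc, ← Matrix.mul_kronecker_mul,
    Matrix.one_mul]

/-- An error that anticommutes with a stabilizer moves the code space to an orthogonal space. -/
theorem conjTranspose_isometry_mul_eq_zero {M N : Op (Q n)} {B' : Op (Q c)} {z : ℂ} (hz : ‖z‖ = 1)
    (hM : M.conjTranspose * M = 1) (hB' : B'.conjTranspose * B' = 1)
    (hL : (M ⊗ₖ B') * C.isometry = z • C.isometry) (hMN : M * N = -(N * M)) :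
    C.isometry.conjTranspose * ((N ⊗ₖ (1 : Op (Q c))) * C.isometry) = 0 := by
  have hS : (M ⊗ₖ B').conjTranspose * (M ⊗ₖ B') = 1 := by
    rw [Matrix.conjTranspose_kronecker, ← Matrix.mul_kronecker_mul, hM, hB',
      Matrix.one_kronecker_one]
  have hanti : (M ⊗ₖ B') * (N ⊗ₖ (1 : Op (Q c))) = -((N ⊗ₖ (1 : Op (Q c))) * (M ⊗ₖ B')) := by
    rw [← Matrix.mul_kronecker_mul, ← Matrix.mul_kronecker_mul, hMN, Matrix.mul_one,
      Matrix.one_mul, ← neg_one_smul ℂ, Matrix.smul_kronecker, neg_one_smul]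
  have hzz : star z * z = 1 := by
    rw [← starRingEnd_apply, Complex.conj_mul', hz]; simp
  -- Insert `(M ⊗ B')† (M ⊗ B')` in front of `N ⊗ I`: both copies are absorbed by the code with
  -- cancelling phases, and passing `N` costs a sign. `B'` does not interfere because the error is
  -- trivial on the receiver's side.
  have key : C.isometry.conjTranspose * ((N ⊗ₖ (1 : Op (Q c))) * C.isometry) =
      -(C.isometry.conjTranspose * ((N ⊗ₖ (1 : Op (Q c))) * C.isometry)) := by
    calc _ = ((M ⊗ₖ B') * C.isometry).conjTranspose *
          ((M ⊗ₖ B') * ((N ⊗ₖ (1 : Op (Q c))) * C.isometry)) := by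
          rw [Matrix.conjTranspose_mul, Matrix.mul_assoc,
            ← Matrix.mul_assoc (M ⊗ₖ B').conjTranspose, hS, Matrix.one_mul]
      _ = _ := by
          rw [← Matrix.mul_assoc (M ⊗ₖ B'), hanti, Matrix.neg_mul, Matrix.mul_assoc _ _ C.isometry,
            hL, Matrix.conjTranspose_smul, Matrix.mul_neg, Matrix.mul_smul, Matrix.mul_smul,
            Matrix.smul_mul, smul_smul, mul_comm z, hzz, one_smul]
  ext x y
  exact self_eq_neg.1 (congrFun (congrFun key x) y)

end Encoding

/-! ### The two alternatives of the error condition -/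

theorem onQubit_mul_transpose {m : ℕ} (j : Fin m) {B : Op (Fin 2)} (h : B * B = 1)
    (ht : B.transpose = B) : onQubit j B * (onQubit j B).transpose = 1 := by
  rw [onQubit_transpose, ht, onQubit_sq j h]

theorem onQubit_conjTranspose_mul {m : ℕ} (j : Fin m) {B : Op (Fin 2)} (h : B * B = 1)
    (hs : star B = B) : (onQubit j B).conjTranspose * onQubit j B = 1 := by
  rw [← Matrix.star_eq_conjTranspose, onQubit_star j hs, onQubit_sq j h]

theorem sigmaX_transpose : sigmaX.transpose = sigmaX := by
  ext a b; fin_cases a <;> fin_cases b <;> simp [sigmaX]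

theorem sigmaZ_transpose : sigmaZ.transpose = sigmaZ := by
  ext a b; fin_cases a <;> fin_cases b <;> simp [sigmaZ]

theorem onQubit_sigmaZ_zero {m : ℕ} (j : Fin m) (x : Q m) :
    onQubit j sigmaZ x 0 = if x = 0 then 1 else 0 := by
  rw [onQubit_sigmaZ, Matrix.diagonal_apply]
  split_ifs with h
  · simp [h, sgn_zero]
  · rfl

theorem one_apply_zero {m : ℕ} (x : Q m) : (1 : Op (Q m)) x 0 = if x = 0 then 1 else 0 :=
  Matrix.one_apply

namespace Encoding

variable {n s c r k : ℕ} (C : Encoding n s c r k) {G : Generators n s c r}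

/-- The Pauli group elements that act on the code as an operator on the gauge qubits. -/
def gaugeActing : Subgroup (pauliGroup n) where
  carrier := {g | ∃ A ∈ Matrix.unitaryGroup (Q r) ℂ,
    (toOp g ⊗ₖ (1 : Op (Q c))) * C.isometry = C.isometry * (A ⊗ₖ (1 : Op (Q k)))}
  one_mem' := ⟨1, one_mem _, by
    rw [toOp_one, Matrix.one_kronecker_one, Matrix.one_kronecker_one, Matrix.one_mul,
      Matrix.mul_one]⟩
  mul_mem' := by
    rintro g h ⟨A, hA, hgA⟩ ⟨B, hB, hhB⟩
    refine ⟨A * B, mul_mem hA hB, ?_⟩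
    rw [toOp_mul, kronecker_one_mul, Matrix.mul_assoc, hhB, ← Matrix.mul_assoc, hgA,
      Matrix.mul_assoc, ← kronecker_one_mul]
  inv_mem' := by
    rintro g ⟨A, hA, hgA⟩
    have hA' : A * A.conjTranspose = 1 := Unitary.mul_star_self_of_mem hA
    have hg : toOp g⁻¹ * toOp g = 1 := by rw [← toOp_mul, inv_mul_cancel, toOp_one]
    refine ⟨A.conjTranspose, Unitary.star_mem hA, ?_⟩
    -- Inserting `A A†` on the gauge factor lets `A` be traded for `g`, which cancels `g⁻¹`.
    calc (toOp g⁻¹ ⊗ₖ (1 : Op (Q c))) * C.isometry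
        = (toOp g⁻¹ ⊗ₖ (1 : Op (Q c))) *
            (C.isometry * ((A * A.conjTranspose) ⊗ₖ (1 : Op (Q k)))) := by
          rw [hA', Matrix.one_kronecker_one, Matrix.mul_one]
      _ = ((toOp g⁻¹ * toOp g) ⊗ₖ (1 : Op (Q c))) *
            (C.isometry * (A.conjTranspose ⊗ₖ (1 : Op (Q k)))) := by
          rw [kronecker_one_mul A, ← Matrix.mul_assoc C.isometry, ← hgA, kronecker_one_mul (toOp g⁻¹)]
          simp only [Matrix.mul_assoc]
      _ = _ := by rw [hg, Matrix.one_kronecker_one, Matrix.one_mul]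

variable {C}

theorem mem_gaugeActing {g : pauliGroup n} {S : Op (Q s)} {A : Op (Q r)}
    (h : ∃ ω : ℂ, ‖ω‖ = 1 ∧
      C.V * (S ⊗ₖ ((1 : Op (Q c)) ⊗ₖ (A ⊗ₖ (1 : Op (Q k))))) * C.V.conjTranspose = ω • toOp g)
    (hS : ∀ x, S x 0 = if x = 0 then 1 else 0) (hA : A ∈ Matrix.unitaryGroup (Q r) ℂ) :
    g ∈ C.gaugeActing := by
  obtain ⟨ω, hω, h⟩ := h
  refine ⟨star ω • A, smul_mem_unitaryGroup (by rwa [norm_star]) hA, ?_⟩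
  rw [kronecker_mul_isometry C (B' := 1) hω h hS (by rw [Matrix.transpose_one, Matrix.mul_one]),
    Matrix.smul_kronecker, Matrix.mul_smul]

/-- It suffices to check generators: phases are scalars, isotropic generators come from `Z`'s that
fix the ancilla state, and gauge generators come from Paulis on the gauge qubits. -/
theorem DefinedBy.le_gaugeActing (hC : C.DefinedBy G) :
    phases n ⊔ (G.isotropic ⊔ G.gauge) ≤ C.gaugeActing := by
  refine sup_le (fun g hg => ?_) (sup_le ?_ ?_)
  · obtain ⟨z, hz, h⟩ := toOp_of_mem_phases hg
    refine ⟨z • 1, smul_mem_unitaryGroup hz (one_mem _), ?_⟩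
    rw [h, Matrix.smul_kronecker, Matrix.smul_kronecker, Matrix.one_kronecker_one,
      Matrix.one_kronecker_one, Matrix.smul_mul, Matrix.mul_smul, Matrix.one_mul, Matrix.mul_one]
  · rw [Generators.isotropic, Subgroup.closure_le]
    rintro _ ⟨i, rfl⟩
    exact mem_gaugeActing (hC.isotropic_Z i) (onQubit_sigmaZ_zero i) (one_mem _)
  · rw [Generators.gauge, Subgroup.closure_le]
    rintro _ (⟨l, rfl⟩ | ⟨l, rfl⟩)
    · exact mem_gaugeActing (hC.gauge_Z l) one_apply_zero (pauliZ l).2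
    · exact mem_gaugeActing (hC.gauge_X l) one_apply_zero (pauliX l).2

/-- The receiver's operator `B'` completes `g` to a stabilizer of the code. Non-commuting Paulis
anticommute, so `h` reverses its eigenvalue. -/
theorem orthogonal_of_not_commute {g h : pauliGroup n} {S : Op (Q s)} {B B' : Op (Q c)}
    (hg : ∃ ω : ℂ, ‖ω‖ = 1 ∧
      C.V * (S ⊗ₖ (B ⊗ₖ ((1 : Op (Q r)) ⊗ₖ (1 : Op (Q k))))) * C.V.conjTranspose = ω • toOp g)
    (hS : ∀ x, S x 0 = if x = 0 then 1 else 0) (hB : B * B'.transpose = 1)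
    (hB' : B'.conjTranspose * B' = 1) (hgh : ¬ Commute g h) :
    C.isometry.conjTranspose * ((toOp h ⊗ₖ (1 : Op (Q c))) * C.isometry) = 0 := by
  obtain ⟨ω, hω, hg⟩ := hg
  have hL := kronecker_mul_isometry C hω hg hS hB
  rw [Matrix.one_kronecker_one, Matrix.mul_one] at hL
  refine conjTranspose_isometry_mul_eq_zero C (by rwa [norm_star])
    (Unitary.star_mul_self_of_mem (toOp_mem g)) hB' hL ((commSign_toOp g h).resolve_left ?_)
  exact fun e => hgh (toOp_injective e)

/-- A nonzero overlap forces `h` to commute with every generator, hence to centralize the subgroup.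
For entanglement generators the receiver applies the same Pauli: `X` and `Z` are symmetric
involutions, so `B Bᵀ = 1`. -/
theorem DefinedBy.orthogonal (hC : C.DefinedBy G) {h : pauliGroup n}
    (hh : h ∉ Subgroup.centralizer
      ((G.isotropic ⊔ G.entanglement : Subgroup (pauliGroup n)) : Set (pauliGroup n))) :
    C.isometry.conjTranspose * ((toOp h ⊗ₖ (1 : Op (Q c))) * C.isometry) = 0 := by
  by_contra hne
  apply hh
  suffices hle : G.isotropic ⊔ G.entanglement ≤ Subgroup.centralizer {h} by
    rw [Subgroup.mem_centralizer_iff]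
    intro g hg
    exact (Subgroup.mem_centralizer_singleton_iff.1 (hle hg))
  have hone : (1 : Op (Q c)).conjTranspose * 1 = 1 := by
    rw [Matrix.conjTranspose_one, Matrix.mul_one]
  refine sup_le ?_ ?_
  · rw [Generators.isotropic, Subgroup.closure_le]
    rintro _ ⟨i, rfl⟩
    refine Subgroup.mem_centralizer_singleton_iff.2 (by_contra fun hg => hne ?_)
    exact orthogonal_of_not_commute (B' := 1) (hC.isotropic_Z i) (onQubit_sigmaZ_zero i)
      (by rw [Matrix.transpose_one, Matrix.mul_one]) hone hg
  · rw [Generators.entanglement, Subgroup.closure_le]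
    rintro _ (⟨j, rfl⟩ | ⟨j, rfl⟩)
    · refine Subgroup.mem_centralizer_singleton_iff.2 (by_contra fun hg => hne ?_)
      exact orthogonal_of_not_commute (hC.entanglement_Z j) one_apply_zero
        (onQubit_mul_transpose j sigmaZ_sq sigmaZ_transpose)
        (onQubit_conjTranspose_mul j sigmaZ_sq sigmaZ_star) hg
    · refine Subgroup.mem_centralizer_singleton_iff.2 (by_contra fun hg => hne ?_)
      exact orthogonal_of_not_commute (hC.entanglement_X j) one_apply_zero
        (onQubit_mul_transpose j sigmaX_sq sigmaX_transpose)
        (onQubit_conjTranspose_mul j sigmaX_sq sigmaX_star) hg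

theorem conjTranspose_error_mul (g h : pauliGroup n) :
    ((toOp g ⊗ₖ (1 : Op (Q c))) * C.isometry).conjTranspose *
      ((toOp h ⊗ₖ (1 : Op (Q c))) * C.isometry) =
    C.isometry.conjTranspose * ((toOp (g⁻¹ * h) ⊗ₖ (1 : Op (Q c))) * C.isometry) := by
  rw [Matrix.conjTranspose_mul, kronecker_one_conjTranspose, ← toOp_inv, toOp_mul,
    kronecker_one_mul]
  simp only [Matrix.mul_assoc]

/-- Errors that differ by isotropic and gauge operators, or are distinguished by the syndrome,
can be corrected. -/
theorem DefinedBy.exists_corrects (hC : C.DefinedBy G) (𝓔 : Set (pauliGroup n))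
    (h𝓔 : ∀ E₁ ∈ 𝓔, ∀ E₂ ∈ 𝓔,
      E₂⁻¹ * E₁ ∈ phases n ⊔ (G.isotropic ⊔ G.gauge) ∨
      E₂⁻¹ * E₁ ∉ Subgroup.centralizer
        ((G.isotropic ⊔ G.entanglement : Subgroup (pauliGroup n)) : Set (pauliGroup n))) :
    ∃ D : Op (Q n × Q c) →ₗ[ℂ] Op (Q k), IsChannel D ∧ C.Corrects D 𝓔 := by
  let N := phases n ⊔ (G.isotropic ⊔ G.gauge)
  have : N.FiniteIndex := Subgroup.finiteIndex_of_le (H := phases n) le_sup_left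
  -- The decoder only has to identify the coset of the error; one representative from `𝓔` is fixed
  -- for each coset that occurs.
  let T : Set (pauliGroup n ⧸ N) := QuotientGroup.mk '' 𝓔
  choose rep rep_mem rep_eq using fun t : T => t.2
  obtain ⟨D, hD, h⟩ := exists_decoder
    (fun t : T => (toOp (rep t) ⊗ₖ (1 : Op (Q c))) * C.isometry)
    (fun t => by
      rw [conjTranspose_error_mul, inv_mul_cancel, toOp_one, Matrix.one_kronecker_one,
        Matrix.one_mul, isometry_isometry])
    (fun t t' htt => by
      rw [conjTranspose_error_mul]
      -- Different cosets rule out the first alternative, so the second one holds and gives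
      -- orthogonality.
      refine hC.orthogonal ((h𝓔 _ (rep_mem t') _ (rep_mem t)).resolve_left fun hN => htt ?_)
      rw [Subtype.ext_iff, ← rep_eq t, ← rep_eq t']
      exact QuotientGroup.eq.2 hN)
  refine ⟨D, hD, fun E hE σ hσ ρ => ?_⟩
  let t : T := ⟨QuotientGroup.mk E, E, hE, rfl⟩
  obtain ⟨A, hA, hEA⟩ := hC.le_gaugeActing (QuotientGroup.eq.1 (rep_eq t))
  -- `E` acts as its representative preceded by the gauge unitary `A`. This only replaces `σ` by `A
  -- σ A†`, again of trace one, which the decoder discards.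
  have hE' : (toOp E ⊗ₖ (1 : Op (Q c))) * C.isometry =
      ((toOp (rep t) ⊗ₖ (1 : Op (Q c))) * C.isometry) * (A ⊗ₖ (1 : Op (Q k))) := by
    rw [Matrix.mul_assoc, ← hEA, ← Matrix.mul_assoc, ← kronecker_one_mul, ← toOp_mul,
      mul_inv_cancel_left]
  have hconj : (A ⊗ₖ (1 : Op (Q k))) * (σ ⊗ₖ ρ) * (A ⊗ₖ (1 : Op (Q k))).conjTranspose =
      (A * σ * A.conjTranspose) ⊗ₖ ρ := by
    rw [kronecker_one_conjTranspose, ← Matrix.mul_kronecker_mul, ← Matrix.mul_kronecker_mul,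
      Matrix.one_mul, Matrix.mul_one]
  have htr : (A * σ * A.conjTranspose).trace = 1 := by
    have hA' : A.conjTranspose * A = 1 := Unitary.star_mul_self_of_mem hA
    rw [Matrix.trace_mul_comm, ← Matrix.mul_assoc, hA', Matrix.one_mul, hσ.2]
  have := h t _ ρ htr
  rw [← hconj] at this
  rw [onAlice_encode, hE', Matrix.conjTranspose_mul _ (A ⊗ₖ (1 : Op (Q k)))]
  simpa only [Matrix.mul_assoc] using this

end Encoding

end EAOQ

theorem mainTheorem1 {n s c r : ℕ} (G : EAOQ.Generators n s c r) :
    ∃ k : ℕ, s + c + r + k = n ∧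
      ∃ C : EAOQ.Encoding n s c r k, C.DefinedBy G ∧
        -- the inverse of an element of the Pauli group is its adjoint
        ∀ 𝓔 : Set (EAOQ.pauliGroup n),
          (∀ E₁ ∈ 𝓔, ∀ E₂ ∈ 𝓔,
            E₂⁻¹ * E₁ ∈ EAOQ.phases n ⊔ (G.isotropic ⊔ G.gauge) ∨
            E₂⁻¹ * E₁ ∉ Subgroup.centralizer
              ((G.isotropic ⊔ G.entanglement : Subgroup (EAOQ.pauliGroup n)) :
                Set (EAOQ.pauliGroup n))) →
          ∃ D : EAOQ.Op (EAOQ.Q n × EAOQ.Q c) →ₗ[ℂ] EAOQ.Op (EAOQ.Q k),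
            EAOQ.IsChannel D ∧ C.Corrects D 𝓔 := by
  obtain ⟨k, hk, C, hC⟩ := G.exists_encoding
  exact ⟨k, hk, C, hC, hC.exists_corrects⟩
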